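/- **Proposition 8.** Let $d\ge 1$ be an integer and $0<\alpha<1$. Consider the following recursive splitting of unity. Let $D_w=(X_{w,1},\dots,X_{w,d+1},Y_w)$, indexed by all finite words $w$ over the alphabet $\{1,\dots,d+1\}$, be independent random vectors, each with the Dirichlet distribution with parameters $(\alpha/d,\dots,\alpha/d,1-\alpha)$, where $\alpha/d$ occurs $d+1$ times. Start with a unit crumb $\xi_\emptyset=1$; the crumb $\xi_w$ splits into $d+1$ crumbs $\xi_{wi}=\xi_wX_{w,i}$ $(1\le i\le d+1)$ and one solid $\eta_w=\xi_wY_w$; crumbs split further and solids do not. Then almost surely $\eta_w\ge 0$ for all $w$ and $\sum_w\eta_w=1$. Paint balls $1,2,\dots$ so that, conditionally given $(\eta_w)_w$, the balls are painted independently, each receiving color $w$ with probability $\eta_w$, and let $\mathcal P$ be the random exchangeable partition of $\{1,2,\dots\}$ into classes of balls of the same color. Then $\mathcal P$ coincides in law with the Ewens–Pitman partition with parameters $(\alpha,\theta)$, $\theta=\alpha/d$. That is: 1. $\mathcal P$ has the same law as the partition obtained by painting balls in the same way from the Poisson–Dirichlet $(\alpha,\theta)$ paintbox $P_j=W_1\cdots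 W_{j-1}(1-W_j)$, $j=1,2,\dots$, where the $W_j$ are independent and $W_j$ has the $\mathrm{beta}(\theta+j\alpha,1-\alpha)$ distribution; 2. if $K_{nr}$ is the number of blocks of size $r$ in the restriction of $\mathcal P$ to the first $n$ balls, then for all $n$ and all nonnegative integers $k_1,\dots,k_n$ with $\sum_r rk_r=n$, writing $\ell=k_1+\dots+k_n$ and $(a)_{i\uparrow}=a(a+1)\cdots(a+i-1)$, $$\mathbb P[K_{n1}=k_1,\dots,K_{nn}=k_n]=n!\,\frac{\theta(\theta+\alpha)\cdots(\theta+(\ell-1)\alpha)}{(\theta)_{n\uparrow}}\prod_{i=1}^n\frac{\big((1-\alpha)_{(i-1)\uparrow}\big)^{k_i}}{(i!)^{k_i}\,k_i!}.$$ -/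

import Mathlib

open MeasureTheory ProbabilityTheory

/-- The Dirichlet distribution with parameters `a i > 0`: the law of `(g i / ∑ j, g j)_i`, where the
`g i` are independent and `g i` has the gamma distribution with shape `a i` and rate `1`. -/
noncomputable def dirichletMeasure {ι : Type*} [Fintype ι] (a : ι → ℝ) : Measure (ι → ℝ) :=
  (Measure.pi fun i => gammaMeasure (a i) 1).map fun g i => g i / ∑ j, g j

/-- The size of the crumb labelled by a word, in a splitting scheme where every crumb splits into
crumbs indexed by `ι` and one solid. `D w (some i)` and `D w none` are the sizes, relative to the
crumb `w`, of its `i`-th crumb child and of its solid child. The unit crumb has the empty label, and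
the `i`-th crumb child of `w` has the label `i :: w` (the latest generation stands first). -/
def crumbSize {ι : Type*} (D : List ι → Option ι → ℝ) : List ι → ℝ
  | [] => 1
  | i :: w => crumbSize D w * D w (some i)

/-- The size of the only solid child of the crumb `w`. The paintbox of the splitting scheme is the
family of these sizes, indexed by all words. -/
def solidSize {ι : Type*} (D : List ι → Option ι → ℝ) (w : List ι) : ℝ :=
  crumbSize D w * D w none

/-- The parameters `(α/d, …, α/d, 1 - α)`: `α/d` for each of the `d + 1` crumbs, `1 - α` for the
solid. -/
noncomputable def splittingParam (d : ℕ) (α : ℝ) : Option (Fin (d + 1)) → ℝ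
  | some _ => α / d
  | none => 1 - α

/-- `C n` is the color of ball `n`: conditionally given the random frequencies `P`, the balls are
painted independently, and each gets the color `j` with probability `P j`. -/
def IsPaintboxSample {Ω J : Type*} [MeasurableSpace Ω] (μ : Measure Ω) (P : J → Ω → ℝ)
    (C : ℕ → Ω → J) : Prop :=
  (∀ n j, MeasurableSet {ω | C n ω = j}) ∧
  ∀ (n : ℕ) (c : Fin n → J) (A : Set (J → ℝ)), MeasurableSet A →
    μ {ω | (fun j => P j ω) ∈ A ∧ ∀ k : Fin n, C k ω = c k} =
      ∫⁻ ω in {ω | (fun j => P j ω) ∈ A}, ∏ k : Fin n, ENNReal.ofReal (P (c k) ω) ∂μ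

/-- Partitions of the set of balls `ℕ` are equivalence relations, with the `σ`-algebra generated by
the events that balls `m` and `n` are in the same block. -/
instance instMeasurableSpaceSetoidNat : MeasurableSpace (Setoid ℕ) :=
  MeasurableSpace.comap (fun s m n => s.r m n) (inferInstance : MeasurableSpace (ℕ → ℕ → Prop))

/-- The partition of the balls into classes of equal color. -/
def colorPartition {Ω J : Type*} (C : ℕ → Ω → J) (ω : Ω) : Setoid ℕ :=
  Setoid.ker fun n => C n ω

/-- The number of blocks of size `r` in the restriction of a partition to the first `n` balls. -/
noncomputable def blockCount (s : Setoid ℕ) (n r : ℕ) : ℕ :=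
  Set.ncard {B : Set (Fin n) | B ∈ (s.comap (Fin.val : Fin n → ℕ)).classes ∧ B.ncard = r}

/-- `P` is a two-parameter Poisson–Dirichlet paintbox, arranged by stick-breaking:
`P j = W 0 ⋯ W (j-1) (1 - W j)` with independent `W j` of law beta`(θ + (j+1) α, 1 - α)`
(indices start from `0`). -/
def IsPoissonDirichletPaintbox {Ω : Type*} [MeasurableSpace Ω] (μ : Measure Ω) (α θ : ℝ)
    (P : ℕ → Ω → ℝ) : Prop :=
  ∃ W : ℕ → Ω → ℝ, (∀ j, Measurable (W j)) ∧ iIndepFun W μ ∧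
    (∀ j : ℕ, μ.map (W j) = betaMeasure (θ + (j + 1) * α) (1 - α)) ∧
    ∀ j ω, P j ω = (∏ i ∈ Finset.range j, W i ω) * (1 - W j ω)

/-- The Ewens–Pitman probability that a partition of `n` balls has `k r` blocks of size `r` for
each `r = 1, …, n`. -/
noncomputable def ewensPitmanProb (α θ : ℝ) (n : ℕ) (k : ℕ → ℕ) : ℝ :=
  n.factorial *
    ((∏ i ∈ Finset.range (∑ r ∈ Finset.Icc 1 n, k r), (θ + i * α)) /
      (ascPochhammer ℝ n).eval θ) *
    ∏ r ∈ Finset.Icc 1 n, ((ascPochhammer ℝ (r - 1)).eval (1 - α)) ^ k r /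
      ((r.factorial : ℝ) ^ k r * (k r).factorial)

open scoped ENNReal

/-! Both partitions come from one kind of tree. Let node `v` carry a parameter `τ v > 0` and split,
independently of the others, by a Dirichlet law with parameters `τ (i :: v)` and `1 - α`, where `∑
i, τ (i :: v) = τ v + α` (`IsSplittingScheme`). The scheme of the theorem has constant `τ = α/d`;
stick-breaking is the unary tree with `τ v = θ + |v| α`. It is enough to show that for every such
scheme a given partition into blocks of sizes `m b` has the Ewens–Pitman probability with parameters
`(α, τ [])`.

Sorting the blocks by the first-generation piece that contains them, at most one being the solid,
gives a recursion for the block probabilities (`blockProb_eq_sum`). The Ewens–Pitman probabilities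
satisfy the same recursion (`ewensPitmanBlocks_eq_sum`), by a multinomial identity for rising
products of step `α`.

The recursion does not terminate: all blocks may fall into one crumb. By induction on the number of
blocks, these are the only terms where the two sides can differ, and their coefficients at `v` add
up to at most `(τ v + α)/(τ v + 1) = 1 - (1 - α)/(τ v + 1)` (`error_le_sum`). Along the tree `τ`
grows by at most `α` per generation, so the errors are multiplied by a product that tends to `0`
because the harmonic series diverges (`tendsto_prod_one_sub_div`). Being uniformly bounded, they
vanish.

A single ball then shows that the solids have expected total mass `1`. Restrictions to finitely many
balls determine the law of the partition, and counting the partitions with given block sizes gives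
the sampling formula. -/

theorem ENNReal.tsum_prod_pi_fin {n : ℕ} {A : Fin n → Type*} (F : ∀ k, A k → ℝ≥0∞) :
    ∑' c : (∀ k, A k), ∏ k, F k (c k) = ∏ k, ∑' a, F k a := by
  induction n with
  | zero => simp
  | succ n ih =>
    rw [← (Fin.consEquiv A).tsum_eq, Fin.prod_univ_succ, ← ih, ENNReal.tsum_prod',
      ← ENNReal.tsum_mul_right]
    refine tsum_congr fun a => ?_
    rw [← ENNReal.tsum_mul_left]
    refine tsum_congr fun c => ?_
    simp [Fin.prod_univ_succ, Fin.consEquiv]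

theorem ENNReal.tsum_prod_pi {K : Type*} [Fintype K] {A : K → Type*} (F : ∀ k, A k → ℝ≥0∞) :
    ∑' c : (∀ k, A k), ∏ k, F k (c k) = ∏ k, ∑' a, F k a := by
  let e := (Fintype.equivFin K).symm
  rw [← (Equiv.piCongrLeft A e).tsum_eq, ← e.prod_comp, ← ENNReal.tsum_prod_pi_fin]
  refine tsum_congr fun c => ?_
  rw [← e.prod_comp]
  simp

/-! ### Sums over injective colorings of the blocks -/

section InjSum

variable {B J K : Type*} [Fintype B]

/-- The sum of `∏ b, x (c b) ^ m b` over all injective `c : B → J`. -/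
noncomputable def injSum (x : J → ℝ≥0∞) (m : B → ℕ) : ℝ≥0∞ :=
  ∑' c : B ↪ J, ∏ b, x (c b) ^ m b

/-- An embedding into `K × J` is a map to `K` together with embeddings of its fibers into `J`. -/
def embeddingProdEquiv (B J K : Type*) :
    (B ↪ K × J) ≃ Σ f : B → K, ∀ k, {b // f b = k} ↪ J where
  toFun c := ⟨fun b => (c b).1, fun k => ⟨fun b => (c b).2, fun b b' h => Subtype.ext
    (c.injective (Prod.ext (b.2.trans b'.2.symm) h))⟩⟩
  invFun p := ⟨fun b => (p.1 b, p.2 (p.1 b) ⟨b, rfl⟩), fun b b' h => by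
    obtain ⟨f, g⟩ := p
    simp only [Prod.mk.injEq] at h
    obtain ⟨h1, h2⟩ := h
    have key : ∀ k (hk : f b = k) (hk' : f b' = k),
        g k ⟨b, hk⟩ = g k ⟨b', hk'⟩ → b = b' := fun k hk hk' h => by
      simpa using (g k).injective h
    refine key (f b) rfl h1.symm (h2.trans ?_)
    have : ∀ k (hk : f b' = k), g (f b') ⟨b', rfl⟩ = g k ⟨b', hk⟩ := by
      rintro _ rfl; rfl
    exact this _ _⟩
  left_inv c := by ext b <;> rfl
  right_inv p := by
    obtain ⟨f, g⟩ := p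
    refine Sigma.ext rfl (heq_of_eq ?_)
    funext k
    ext ⟨b, rfl⟩
    rfl

theorem injSum_prod [Fintype K] [DecidableEq K] [DecidableEq B] (z : K → J → ℝ≥0∞) (m : B → ℕ) :
    injSum (fun p : K × J => z p.1 p.2) m =
      ∑ f : B → K, ∏ k, injSum (z k) (fun b : {b // f b = k} => m b) := by
  unfold injSum
  rw [← (embeddingProdEquiv B J K).symm.tsum_eq, ENNReal.tsum_sigma', tsum_fintype]
  refine Finset.sum_congr rfl fun f _ => ?_
  rw [← ENNReal.tsum_prod_pi]
  refine tsum_congr fun g => ?_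
  rw [← Fintype.prod_fiberwise f]
  refine Finset.prod_congr rfl fun k _ => ?_
  refine Finset.prod_congr rfl ?_
  rintro ⟨b, rfl⟩ _
  rfl

/-- As all exponents are nonzero, a coloring that uses a color of weight zero contributes nothing.
This permits a change of the index set of colors. -/
theorem injSum_comp_of_support {J' : Type*} (e : J' ↪ J) (x : J → ℝ≥0∞) (m : B → ℕ)
    (hm : ∀ b, m b ≠ 0) (hx : ∀ j, x j ≠ 0 → j ∈ Set.range e) :
    injSum (fun j => x (e j)) m = injSum x m := by
  unfold injSum
  have hinj : Function.Injective fun c : B ↪ J' => c.trans e := fun c c' h => by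
    ext b
    exact e.injective (by simpa using DFunLike.congr_fun h b)
  refine (hinj.tsum_eq (f := fun c : B ↪ J => ∏ b, x (c b) ^ m b) ?_)
  intro c hc
  have hc' : ∀ b, ∃ j, e j = c b := fun b => hx _ fun h0 =>
    hc (Finset.prod_eq_zero (Finset.mem_univ b) (by simp [h0, hm b]))
  choose g hg using hc'
  refine ⟨⟨g, fun b b' h => c.injective (by rw [← hg, ← hg, h])⟩, ?_⟩
  ext b
  exact hg b

theorem injSum_equiv {B' : Type*} [Fintype B'] (e : B' ≃ B) (x : J → ℝ≥0∞) (m : B → ℕ) :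
    injSum x (fun b => m (e b)) = injSum x m := by
  unfold injSum
  rw [← (Equiv.embeddingCongr e (Equiv.refl J)).tsum_eq]
  refine tsum_congr fun c => ?_
  rw [← e.prod_comp]
  simp

theorem injSum_of_isEmpty [IsEmpty B] (x : J → ℝ≥0∞) (m : B → ℕ) : injSum x m = 1 := by
  unfold injSum
  rw [tsum_fintype]
  simp

/-- A single color can hold at most one block. This is the origin of the condition that at most one
block goes to the solid. -/
theorem injSum_single [DecidableEq J] (j₀ : J) (y : ℝ≥0∞) (m : B → ℕ) (hm : ∀ b, m b ≠ 0) :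
    injSum (fun j => if j = j₀ then y else 0) m =
      if Nat.card B ≤ 1 then y ^ ∑ b, m b else 0 := by
  rw [← injSum_comp_of_support (J' := Unit) ⟨fun _ => j₀, fun _ _ _ => rfl⟩ _ m hm
    (fun j hj => ⟨(), by by_contra h; exact hj (if_neg (Ne.symm h))⟩)]
  change (∑' c : B ↪ Unit, ∏ b, (if j₀ = j₀ then y else 0) ^ m b) = _
  simp only [if_true, Finset.prod_pow_eq_pow_sum]
  split_ifs with h
  · have := Finite.card_le_one_iff_subsingleton.1 h
    have : Unique (B ↪ Unit) := ⟨⟨⟨fun _ => (), fun _ _ _ => Subsingleton.elim _ _⟩⟩,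
      fun _ => by ext⟩
    rw [tsum_fintype]
    simp
  · have : IsEmpty (B ↪ Unit) := ⟨fun c => h (by
      rw [Nat.card_eq_fintype_card]
      simpa using Fintype.card_le_of_embedding c)⟩
    simp

theorem injSum_smul (a : ℝ≥0∞) (x : J → ℝ≥0∞) (m : B → ℕ) :
    injSum (fun j => a * x j) m = a ^ (∑ b, m b) * injSum x m := by
  unfold injSum
  rw [← ENNReal.tsum_mul_left]
  refine tsum_congr fun c => ?_
  simp [mul_pow, Finset.prod_mul_distrib, Finset.prod_pow_eq_pow_sum]

/-- Dropping injectivity turns the sum into a product of sums, each at most `∑' j, x j` because the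
exponents are at least `1`. -/
theorem injSum_le_one (x : J → ℝ≥0∞) (m : B → ℕ) (hm : ∀ b, m b ≠ 0) (hx : ∑' j, x j ≤ 1) :
    injSum x m ≤ 1 := by
  classical
  calc injSum x m ≤ ∑' c : B → J, ∏ b, x (c b) ^ m b :=
        ENNReal.tsum_comp_le_tsum_of_injective (f := fun c : B ↪ J => (c : B → J))
          DFunLike.coe_injective (fun c : B → J => ∏ b, x (c b) ^ m b)
    _ = ∏ b, ∑' j, x j ^ m b := ENNReal.tsum_prod_pi fun b j => x j ^ m b
    _ ≤ ∏ b : B, 1 := by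
        refine Finset.prod_le_prod' fun b _ => le_trans (ENNReal.tsum_le_tsum fun j => ?_) hx
        exact pow_le_of_le_one (by positivity) ((ENNReal.le_tsum j).trans hx) (hm b)
    _ = 1 := by simp

theorem injSum_unit (x : J → ℝ≥0∞) : injSum x (fun _ : Unit => 1) = ∑' j, x j := by
  unfold injSum
  rw [← (Equiv.ofBijective (fun j : J => (⟨fun _ => j, fun _ _ _ => rfl⟩ : Unit ↪ J))
    ⟨fun j j' h => DFunLike.congr_fun h (), fun c => ⟨c (), by ext; rfl⟩⟩).tsum_eq]
  refine tsum_congr fun j => ?_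
  simp only [Finset.univ_unique, Finset.prod_singleton, pow_one]
  rfl

end InjSum

/-! ### The recursion satisfied by the Ewens–Pitman probabilities -/

section EwensPitman

/-- The Ewens–Pitman probability of a partition into blocks indexed by `B`, of sizes `m b`. -/
noncomputable def ewensPitmanBlocks {B : Type*} [Fintype B] (α θ : ℝ) (m : B → ℕ) : ℝ :=
  (∏ i ∈ Finset.range (Nat.card B), (θ + i * α)) / (ascPochhammer ℝ (∑ b, m b)).eval θ *
    ∏ b, (ascPochhammer ℝ (m b - 1)).eval (1 - α)

/-- The mixed moment `∏ k, (a k)_{r k} / (∑ k, a k)_{∑ k, r k}` of the Dirichlet distribution. -/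
noncomputable def dirichletMoment {K : Type*} [Fintype K] (a : K → ℝ) (r : K → ℕ) : ℝ :=
  (∏ k, (ascPochhammer ℝ (r k)).eval (a k)) / (ascPochhammer ℝ (∑ k, r k)).eval (∑ k, a k)

variable {ι : Type*} [Fintype ι]

theorem card_fiber_option {B : Type*} [Fintype B] {K : Type*} [DecidableEq K]
    (f : Option B → K) (k : K) :
    Nat.card {b // f b = k} =
      Nat.card {b // f (some b) = k} + if f none = k then 1 else 0 := by
  simp only [Nat.card_eq_fintype_card, Fintype.card_subtype, Finset.card_filter, Fintype.sum_option]
  rw [add_comm]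

theorem card_fiber_comp_equiv {B B' : Type*} {K : Type*}
    (e : B' ≃ B) (f : B → K) (k : K) :
    Nat.card {b // (f ∘ e) b = k} = Nat.card {b // f b = k} :=
  Nat.card_congr (e.subtypeEquiv fun _ => Iff.rfl)

/-- The weight of an assignment of blocks to crumbs (`some i`) and to the solid (`none`). -/
noncomputable def splitWeight {B : Type*} [Fintype B] (α : ℝ) (a : ι → ℝ) (m : B → ℕ)
    (f : B → Option ι) : ℝ :=
  (∏ b, if f b = none then (m b - α : ℝ) else 1) *
    ∏ i, ∏ j ∈ Finset.range (Nat.card {b // f b = some i}), (a i + j * α)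

/-- Blocks are seated one at a time, as in a Chinese restaurant: the new block gains a factor that
depends only on its own place and on the number of blocks already there. -/
theorem splitWeight_option {B : Type*} [Fintype B] (α : ℝ) (a : ι → ℝ) (m : Option B → ℕ)
    (f : Option B → Option ι) :
    splitWeight α a m f = splitWeight α a (fun b => m (some b)) (fun b => f (some b)) *
      match f none with
      | none => (m none - α : ℝ)
      | some i => a i + Nat.card {b // f (some b) = some i} * α := by
  classical
  unfold splitWeight
  rw [Fintype.prod_option]
  rcases h : f none with _ | i
  · simp only [card_fiber_option, h]
    simp
    ring
  · have : ∀ i', (∏ j ∈ Finset.range (Nat.card {b // f b = some i'}), (a i' + j * α)) =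
        (∏ j ∈ Finset.range (Nat.card {b // f (some b) = some i'}), (a i' + j * α)) *
          if i' = i then (a i + Nat.card {b // f (some b) = some i} * α) else 1 := by
      intro i'
      rw [card_fiber_option, h]
      by_cases hi : i' = i
      · subst hi; simp [Finset.prod_range_succ]
      · simp [hi, Ne.symm hi]
    simp only [this, Finset.prod_mul_distrib]
    simp
    ring

theorem sum_card_fiber_some {B : Type*} [Fintype B] (f : B → Option ι) :
    ∑ i, (Nat.card {b // f b = some i} : ℝ) + Nat.card {b // f b = none} =
      Nat.card B := by
  have := Nat.card_congr (Equiv.sigmaFiberEquiv f)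
  rw [Nat.card_sigma, Fintype.sum_option] at this
  rw [← this]
  push_cast
  ring

theorem sum_splitWeight_comp_equiv {B B' : Type*} [Fintype B] [Fintype B'] [DecidableEq B]
    [DecidableEq B'] (e : B' ≃ B) (α : ℝ) (a : ι → ℝ) (m : B → ℕ) (c : ℕ) :
    ∑ f : B' → Option ι, (if Nat.card {b // f b = none} = c then
      splitWeight α a (m ∘ e) f else 0) =
    ∑ f : B → Option ι, if Nat.card {b // f b = none} = c then splitWeight α a m f else 0 := by
  rw [← (Equiv.arrowCongr e (Equiv.refl (Option ι))).symm.sum_comp]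
  refine Finset.sum_congr rfl fun f _ => ?_
  have h : ∀ k, Nat.card {b // (Equiv.arrowCongr e (Equiv.refl (Option ι))).symm f b = k} =
    Nat.card {b // f b = k} := fun k => card_fiber_comp_equiv e f k
  simp only [splitWeight, h]
  congr 2
  rw [← e.prod_comp]
  rfl

/-- Summed over the crumbs, the factors of the new block depend only on how many blocks are already
in crumbs, so the sum over assignments obeys a closed recursion. -/
theorem sum_splitWeight_option {B : Type*} [Fintype B] [DecidableEq B] (α : ℝ) (a : ι → ℝ)
    (m : Option B → ℕ) (c : ℕ) :
    ∑ f : Option B → Option ι, (if Nat.card {b // f b = none} = c then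
      splitWeight α a m f else 0) =
    ∑ f : B → Option ι, (if Nat.card {b // f b = none} = c then
      splitWeight α a (fun b => m (some b)) f * (∑ i, a i + (Nat.card B - c) * α) else 0) +
    ∑ f : B → Option ι, (if Nat.card {b // f b = none} + 1 = c then
      splitWeight α a (fun b => m (some b)) f * (m none - α) else 0) := by
  classical
  let e : (Option ι × (B → Option ι)) ≃ (Option B → Option ι) :=
    (Equiv.piOptionEquivProd (β := fun _ : Option B => Option ι)).symm
  rw [← e.sum_comp, Fintype.sum_prod_type_right, ← Finset.sum_add_distrib]
  refine Finset.sum_congr rfl fun f _ => ?_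
  have h1 : ∀ k, e (k, f) none = k := fun _ => rfl
  have h2 : ∀ k b, e (k, f) (some b) = f b := fun _ _ => rfl
  simp only [splitWeight_option, card_fiber_option, h1, h2, Fintype.sum_option]
  simp only [if_true, reduceCtorEq, if_false, add_zero]
  rw [add_comm]
  congr 1
  split_ifs with h
  · rw [← Finset.mul_sum, Finset.sum_add_distrib, ← Finset.sum_mul, ← sum_card_fiber_some f, h]
    ring
  · simp

/-- The first identity is the multinomial theorem for rising products of step `α`; the second has
one block set aside in the solid. Both follow by adding blocks one by one. -/
theorem sum_splitWeight {B : Type*} [Fintype B] [DecidableEq B] (α : ℝ) (a : ι → ℝ)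
    (m : B → ℕ) :
    ∑ f : B → Option ι, (if Nat.card {b // f b = none} = 0 then splitWeight α a m f else 0) =
      ∏ j ∈ Finset.range (Nat.card B), (∑ i, a i + j * α) ∧
    ∑ f : B → Option ι, (if Nat.card {b // f b = none} = 1 then splitWeight α a m f else 0) =
      (∑ b, (m b : ℝ) - Nat.card B * α) *
        ∏ j ∈ Finset.range (Nat.card B - 1), (∑ i, a i + j * α) := by
  revert m
  rename_i inst
  revert inst
  refine @Fintype.induction_empty_option (P := fun B _ => ∀ (_ : DecidableEq B) (m : B → ℕ),
    ∑ f : B → Option ι, (if Nat.card {b // f b = none} = 0 then splitWeight α a m f else 0) =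
      ∏ j ∈ Finset.range (Nat.card B), (∑ i, a i + j * α) ∧
    ∑ f : B → Option ι, (if Nat.card {b // f b = none} = 1 then splitWeight α a m f else 0) =
      (∑ b, (m b : ℝ) - Nat.card B * α) *
        ∏ j ∈ Finset.range (Nat.card B - 1), (∑ i, a i + j * α)) ?_ ?_ ?_ B _
  · intro B B' _ e ih _ m
    let _ := Fintype.ofEquiv B' e.symm
    let inst : DecidableEq B := Classical.decEq B
    have := ih inst (m ∘ e)
    rw [sum_splitWeight_comp_equiv e, sum_splitWeight_comp_equiv e, Nat.card_congr e] at this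
    rw [← e.sum_comp fun b => (m b : ℝ)]
    exact this
  · intro _ m
    simp [splitWeight]
  · intro B _ ih inst m
    let inst' : DecidableEq B := Classical.decEq B
    obtain rfl : inst = Option.instDecidableEq := Subsingleton.elim _ _
    obtain ⟨ih0, ih1⟩ := ih inst' fun b => m (some b)
    have h0 := sum_splitWeight_option α a m 0
    have h1 := sum_splitWeight_option α a m 1
    simp only [Nat.add_eq_zero_iff, one_ne_zero, and_false, if_false, Finset.sum_const_zero,
      add_eq_right, ← ite_zero_mul, ← Finset.sum_mul] at h0 h1
    rw [ih0] at h0 h1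
    rw [ih1] at h1
    constructor
    · rw [h0, Finite.card_option, Finset.prod_range_succ]
      simp
    · rw [h1, Finite.card_option, Fintype.sum_option, Nat.add_sub_cancel]
      -- For empty `B` the truncated `Nat.card B - 1` is harmless, since its coefficient `∑ m b -
      -- |B| α` vanishes.
      rcases h : Nat.card B with _ | l
      · have : IsEmpty B := Finite.card_eq_zero_iff.1 h
        simp
      · rw [Nat.add_sub_cancel, Finset.prod_range_succ]
        push_cast
        ring

/-- The parameters of a splitting: `τ i` for the `i`-th crumb, `1 - α` for the solid. -/
def splitParam (α : ℝ) (τ : ι → ℝ) : Option ι → ℝ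
  | some i => τ i
  | none => 1 - α

/-- The Pochhammer factors of the crumbs in the Dirichlet moment cancel the denominators of the
Ewens–Pitman factors. A block in the solid gives `(1-α)_m = (1-α)_{m-1} (m - α)`. Only `splitWeight`
still depends on `f`. -/
theorem dirichletMoment_mul_prod_ewensPitmanBlocks [DecidableEq ι] {B : Type*} [Fintype B]
    {α : ℝ} {τ : ι → ℝ} (hτ : ∀ i, 0 < τ i) (m : B → ℕ) (hm : ∀ b, m b ≠ 0)
    (f : B → Option ι) (hf : Nat.card {b // f b = none} ≤ 1) :
    dirichletMoment (splitParam α τ) (fun k => ∑ b : {b // f b = k}, m b) *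
      ∏ i, ewensPitmanBlocks α (τ i) (fun b : {b // f b = some i} => m b) =
    (∏ b, (ascPochhammer ℝ (m b - 1)).eval (1 - α)) /
      (ascPochhammer ℝ (∑ b, m b)).eval (∑ i, τ i + 1 - α) * splitWeight α τ m f := by
  have hsum : ∑ k, ∑ b : {b // f b = k}, m b = ∑ b, m b := Fintype.sum_fiberwise f m
  have hpar : ∑ k, splitParam α τ k = ∑ i, τ i + 1 - α := by
    rw [Fintype.sum_option]
    simp only [splitParam]
    ring
  have hnone : (ascPochhammer ℝ (∑ b : {b // f b = none}, m b)).eval (1 - α) =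
      ∏ b : {b // f b = none}, (ascPochhammer ℝ (m b - 1)).eval (1 - α) * (m b - α : ℝ) := by
    have := Finite.card_le_one_iff_subsingleton.1 hf
    rcases isEmpty_or_nonempty {b // f b = none} with h | ⟨⟨b⟩⟩
    · simp
    · rw [Fintype.sum_subsingleton _ b, Fintype.prod_subsingleton _ b]
      obtain ⟨l, hl⟩ := Nat.exists_eq_succ_of_ne_zero (hm b)
      rw [hl, Nat.succ_eq_add_one, ascPochhammer_succ_eval]
      simp only [Nat.add_sub_cancel]
      push_cast
      ring
  have hfib : ∀ g : B → ℝ, ∏ b, g b =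
      (∏ b : {b // f b = none}, g b) * ∏ i, ∏ b : {b // f b = some i}, g b := fun g => by
    rw [← Fintype.prod_fiberwise f, Fintype.prod_option]
  have hpos : ∀ i, (ascPochhammer ℝ (∑ b : {b // f b = some i}, m b)).eval (τ i) ≠ 0 :=
    fun i => (ascPochhammer_pos _ _ (hτ i)).ne'
  have hite : (∏ b, if f b = none then (m b - α : ℝ) else 1) =
      ∏ b : {b // f b = none}, (m b - α : ℝ) := by
    rw [hfib]
    have h1 : ∀ b : {b // f b = none}, (if f b = none then (m b - α : ℝ) else 1) = m b - α :=
      fun b => if_pos b.2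
    have h2 : ∀ i, ∀ b : {b // f b = some i}, (if f b = none then (m b - α : ℝ) else 1) = 1 :=
      fun i b => if_neg (by simp [b.2])
    simp only [h1, h2, Finset.prod_const_one, mul_one]
  unfold dirichletMoment ewensPitmanBlocks splitWeight
  rw [hsum, hpar, Fintype.prod_option, hite, hfib fun b => (ascPochhammer ℝ (m b - 1)).eval (1 - α)]
  simp only [splitParam, hnone, Finset.prod_mul_distrib, Finset.prod_div_distrib]
  have : ∏ i, (ascPochhammer ℝ (∑ b : {b // f b = some i}, m b)).eval (τ i) ≠ 0 :=
    Finset.prod_ne_zero_iff.2 fun i _ => hpos i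
  field_simp

/-- With `|B| = l + 1`, `n = ∑ m b` and `Q = ∏_{j<l} (θ + α + jα)`, the assignments without a solid
block sum to `Q (θ + α + lα)` and those with one to `Q (n - (l+1)α)`. The total is `Q (θ + n)`, and
`(θ+1)_n θ = (θ)_n (θ + n)` closes the computation. -/
theorem ewensPitmanBlocks_eq_sum [DecidableEq ι] {B : Type*} [Fintype B] [DecidableEq B]
    [Nonempty B] {α θ : ℝ} {τ : ι → ℝ} (hθ : 0 < θ) (hτ : ∀ i, 0 < τ i)
    (hsum : ∑ i, τ i = θ + α) (m : B → ℕ) (hm : ∀ b, m b ≠ 0) :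
    ewensPitmanBlocks α θ m = ∑ f : B → Option ι, if Nat.card {b // f b = none} ≤ 1 then
      dirichletMoment (splitParam α τ) (fun k => ∑ b : {b // f b = k}, m b) *
        ∏ i, ewensPitmanBlocks α (τ i) (fun b : {b // f b = some i} => m b) else 0 := by
  have key : ∀ f : B → Option ι, (if Nat.card {b // f b = none} ≤ 1 then
      dirichletMoment (splitParam α τ) (fun k => ∑ b : {b // f b = k}, m b) *
        ∏ i, ewensPitmanBlocks α (τ i) (fun b : {b // f b = some i} => m b) else 0) =
      (∏ b, (ascPochhammer ℝ (m b - 1)).eval (1 - α)) /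
        (ascPochhammer ℝ (∑ b, m b)).eval (θ + 1) *
      ((if Nat.card {b // f b = none} = 0 then splitWeight α τ m f else 0) +
        if Nat.card {b // f b = none} = 1 then splitWeight α τ m f else 0) := by
    intro f
    split_ifs with h h0 h1 h1
    · omega
    · rw [dirichletMoment_mul_prod_ewensPitmanBlocks hτ m hm f h, hsum, add_zero]
      congr 4; ring
    · rw [dirichletMoment_mul_prod_ewensPitmanBlocks hτ m hm f h, hsum, zero_add]
      congr 4; ring
    · omega
    all_goals first | omega | simp
  obtain ⟨s0, s1⟩ := sum_splitWeight α τ m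
  rw [Finset.sum_congr rfl fun f _ => key f, ← Finset.mul_sum, Finset.sum_add_distrib, s0, s1, hsum]
  obtain ⟨l, hl⟩ := Nat.exists_eq_succ_of_ne_zero (Nat.card_pos (α := B)).ne'
  have hpoch : (ascPochhammer ℝ (∑ b, m b)).eval (θ + 1) * θ =
      (ascPochhammer ℝ (∑ b, m b)).eval θ * (θ + ∑ b, (m b : ℝ)) := by
    have h1 := ascPochhammer_succ_eval (∑ b, m b) θ
    rw [ascPochhammer_succ_left] at h1
    simp at h1
    rw [← h1]; ring
  have p1 := ascPochhammer_pos (∑ b, m b) θ hθ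
  have p2 := ascPochhammer_pos (∑ b, m b) (θ + 1) (by positivity)
  unfold ewensPitmanBlocks
  have hL : ∏ i ∈ Finset.range (l + 1), (θ + i * α) =
      (∏ j ∈ Finset.range l, (θ + α + j * α)) * θ := by
    rw [Finset.prod_range_succ']
    congr 1
    · exact Finset.prod_congr rfl fun j _ => by push_cast; ring
    · simp
  rw [hl, Nat.succ_eq_add_one, Nat.add_sub_cancel, hL, Finset.prod_range_succ]
  generalize ∏ j ∈ Finset.range l, (θ + α + j * α) = Q
  generalize ∏ b, (ascPochhammer ℝ (m b - 1)).eval (1 - α) = R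
  rw [div_mul_eq_mul_div, div_mul_eq_mul_div, div_eq_div_iff p1.ne' p2.ne']
  push_cast
  linear_combination Q * R * hpoch

theorem ewensPitmanBlocks_nonneg {B : Type*} [Fintype B] {α θ : ℝ} (hα0 : 0 < α) (hα1 : α < 1)
    (hθ : 0 < θ) (m : B → ℕ) : 0 ≤ ewensPitmanBlocks α θ m := by
  unfold ewensPitmanBlocks
  have := ascPochhammer_pos (∑ b, m b) θ hθ
  have h2 : ∀ b, 0 < (ascPochhammer ℝ (m b - 1)).eval (1 - α) :=
    fun b => ascPochhammer_pos _ _ (by linarith)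
  have := Finset.prod_nonneg fun b (_ : b ∈ Finset.univ) => (h2 b).le
  positivity

theorem prod_le_ascPochhammer {α θ : ℝ} (hα0 : 0 < α) (hα1 : α < 1) (hθ : 0 < θ) {l n : ℕ}
    (hl : l ≠ 0) (hln : l ≤ n) :
    ∏ i ∈ Finset.range l, (θ + i * α) ≤ (ascPochhammer ℝ n).eval θ := by
  induction n, hln using Nat.le_induction with
  | base =>
    have h : ∀ l, (ascPochhammer ℝ l).eval θ = ∏ i ∈ Finset.range l, (θ + i) := fun l => by
      induction l with
      | zero => simp
      | succ l ih => rw [ascPochhammer_succ_eval, ih, Finset.prod_range_succ]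
    rw [h]
    refine Finset.prod_le_prod (fun i _ => by positivity) fun i _ => ?_
    nlinarith [Nat.cast_nonneg (α := ℝ) i]
  | succ n hn ih =>
    rw [ascPochhammer_succ_eval]
    have : (1 : ℝ) ≤ n := by exact_mod_cast (Nat.one_le_iff_ne_zero.2 hl).trans hn
    have := ascPochhammer_pos n θ hθ
    nlinarith

/-- A bound free of `θ` is needed, because the parameter may grow without bound along the tree. -/
theorem ewensPitmanBlocks_le {B : Type*} [Fintype B] [Nonempty B] {α θ : ℝ} (hα0 : 0 < α)
    (hα1 : α < 1) (hθ : 0 < θ) (m : B → ℕ) (hm : ∀ b, m b ≠ 0) :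
    ewensPitmanBlocks α θ m ≤ ∏ b, (ascPochhammer ℝ (m b - 1)).eval (1 - α) := by
  unfold ewensPitmanBlocks
  have h2 : ∀ b, 0 < (ascPochhammer ℝ (m b - 1)).eval (1 - α) :=
    fun b => ascPochhammer_pos _ _ (by linarith)
  refine mul_le_of_le_one_left (Finset.prod_nonneg fun b _ => (h2 b).le) ?_
  rw [div_le_one (ascPochhammer_pos _ _ hθ)]
  refine prod_le_ascPochhammer hα0 hα1 hθ Nat.card_pos.ne' ?_
  rw [Nat.card_eq_fintype_card, Fintype.card_eq_sum_ones]
  exact Finset.sum_le_sum fun b _ => Nat.one_le_iff_ne_zero.2 (hm b)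

end EwensPitman

/-! ### Splitting trees and the recursion for block probabilities -/

section SplittingTree

variable {ι : Type*}

/-- The latest generation stands first, so the last letter is the choice made at the root; removing
it leaves the same construction in the subtree of `[i]`. -/
theorem crumbSize_append_singleton (D : List ι → Option ι → ℝ) (w : List ι) (i : ι) :
    crumbSize D (w ++ [i]) = D [] (some i) * crumbSize (fun u => D (u ++ [i])) w := by
  induction w with
  | nil => simp [crumbSize]
  | cons j w ih => rw [List.cons_append, crumbSize, ih, crumbSize, mul_assoc]

theorem solidSize_append_singleton (D : List ι → Option ι → ℝ) (w : List ι) (i : ι) :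
    solidSize D (w ++ [i]) = D [] (some i) * solidSize (fun u => D (u ++ [i])) w := by
  rw [solidSize, crumbSize_append_singleton, solidSize, mul_assoc]

theorem crumbSize_nonneg {D : List ι → Option ι → ℝ} (hD : ∀ v k, 0 ≤ D v k) (w : List ι) :
    0 ≤ crumbSize D w := by
  induction w with
  | nil => simp [crumbSize]
  | cons i w ih => exact mul_nonneg ih (hD _ _)

theorem solidSize_nonneg {D : List ι → Option ι → ℝ} (hD : ∀ v k, 0 ≤ D v k) (w : List ι) :
    0 ≤ solidSize D w :=
  mul_nonneg (crumbSize_nonneg hD w) (hD _ _)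

/-- The sizes of the solids in the subtree of the node `v`, relative to the crumb `v`. -/
noncomputable def subtreeSolid (D : List ι → Option ι → ℝ) (v w : List ι) : ℝ≥0∞ :=
  ENNReal.ofReal (solidSize (fun u => D (u ++ v)) w)

theorem subtreeSolid_nil (D : List ι → Option ι → ℝ) (v : List ι) :
    subtreeSolid D v [] = ENNReal.ofReal (D v none) := by
  simp [subtreeSolid, solidSize, crumbSize]

theorem subtreeSolid_append_singleton (D : List ι → Option ι → ℝ) (v w : List ι) (i : ι)
    (h : 0 ≤ D v (some i)) :
    subtreeSolid D v (w ++ [i]) = ENNReal.ofReal (D v (some i)) * subtreeSolid D (i :: v) w := by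
  rw [subtreeSolid, solidSize_append_singleton, List.nil_append, ENNReal.ofReal_mul h]
  simp [subtreeSolid]

/-- A nonempty word is split into its last letter and the rest. -/
def unsnocEmbedding (ι : Type*) : List ι ↪ Option ι × List ι where
  toFun w := match w.reverse with
    | [] => (none, [])
    | i :: t => (some i, t.reverse)
  inj' w w' h := by
    rcases w.eq_nil_or_concat with rfl | ⟨t, i, rfl⟩ <;>
      rcases w'.eq_nil_or_concat with rfl | ⟨t', i', rfl⟩ <;> simp_all

theorem unsnocEmbedding_nil : unsnocEmbedding ι [] = (none, []) := rfl

theorem unsnocEmbedding_append_singleton (w : List ι) (i : ι) :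
    unsnocEmbedding ι (w ++ [i]) = (some i, w) := by
  change (match (w ++ [i]).reverse with
    | [] => (none, [])
    | i :: t => (some i, t.reverse)) = _
  simp

theorem tsum_list_eq [Fintype ι] (F : List ι → ℝ≥0∞) :
    ∑' w, F w = F [] + ∑ i, ∑' w, F (w ++ [i]) := by
  classical
  let G : Option ι → List ι → ℝ≥0∞ := fun k j => match k with
    | none => if j = [] then F [] else 0
    | some i => F (j ++ [i])
  have h : ∑' w, F w = ∑' p : Option ι × List ι, G p.1 p.2 := by
    rw [← (unsnocEmbedding ι).injective.tsum_eq]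
    · refine tsum_congr fun w => ?_
      rcases w.eq_nil_or_concat with rfl | ⟨t, i, rfl⟩
      · simp [unsnocEmbedding_nil, G]
      · simp [unsnocEmbedding_append_singleton, G]
    · rintro ⟨_ | i, j⟩ hp
      · refine ⟨[], ?_⟩
        by_contra hj
        exact hp (if_neg fun h => hj (Prod.ext rfl h.symm))
      · exact ⟨j ++ [i], unsnocEmbedding_append_singleton j i⟩
  rw [h, ENNReal.tsum_prod', tsum_fintype, Fintype.sum_option]
  simp [G]

/-- Truncated at depth `n`, the mass is at most `1` by induction on `n`. Pathwise only the
inequality holds, as mass may escape to infinite depth; equality is obtained almost surely in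
`ae_hasSum`. -/
theorem tsum_subtreeSolid_le_one [Fintype ι] {D : List ι → Option ι → ℝ}
    (hD : ∀ v k, 0 ≤ D v k) (hsum : ∀ v, ∑ k, D v k = 1) (v : List ι) :
    ∑' w, subtreeSolid D v w ≤ 1 := by
  have key : ∀ (n : ℕ) (v : List ι),
      ∑' w, (if w.length < n then subtreeSolid D v w else 0) ≤ 1 := by
    intro n
    induction n with
    | zero => simp
    | succ n ih =>
      intro v
      rw [tsum_list_eq]
      have h1 : (1 : ℝ≥0∞) =
          ENNReal.ofReal (D v none) + ∑ i, ENNReal.ofReal (D v (some i)) * 1 := by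
        simp only [mul_one]
        rw [← Fintype.sum_option fun k => ENNReal.ofReal (D v k),
          ← ENNReal.ofReal_sum_of_nonneg fun k _ => hD v k, hsum, ENNReal.ofReal_one]
      rw [h1]
      refine add_le_add (by simp [subtreeSolid_nil]) (Finset.sum_le_sum fun i _ => ?_)
      refine le_trans (le_of_eq ?_) (mul_le_mul_right (ih (i :: v)) _)
      rw [← ENNReal.tsum_mul_left]
      refine tsum_congr fun w => ?_
      rw [subtreeSolid_append_singleton _ _ _ _ (hD _ _)]
      simp
  rw [ENNReal.tsum_eq_iSup_sum]
  refine iSup_le fun s => ?_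
  refine le_trans ?_ (key (s.sup List.length + 1) v)
  refine le_trans (Finset.sum_le_sum fun w hw => ?_) (ENNReal.sum_le_tsum s)
  rw [if_pos (Nat.lt_succ_of_le (Finset.le_sup (f := List.length) hw))]

theorem injSum_subtreeSolid [Fintype ι] [DecidableEq ι] {B : Type*} [Fintype B] [DecidableEq B]
    (D : List ι → Option ι → ℝ) (v : List ι) (hD : ∀ k, 0 ≤ D v k) (m : B → ℕ)
    (hm : ∀ b, m b ≠ 0) :
    injSum (subtreeSolid D v) m = ∑ f : B → Option ι, if Nat.card {b // f b = none} ≤ 1 then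
      (∏ k, ENNReal.ofReal (D v k) ^ (∑ b : {b // f b = k}, m b)) *
        ∏ i, injSum (subtreeSolid D (i :: v)) (fun b : {b // f b = some i} => m b) else 0 := by
  -- The root solid is the color `(none, [])`; the other pairs `(none, j)` get weight zero and do
  -- not matter.
  let G : Option ι → List ι → ℝ≥0∞ := fun k => match k with
    | none => fun j => if j = [] then ENNReal.ofReal (D v none) else 0
    | some i => fun j => ENNReal.ofReal (D v (some i)) * subtreeSolid D (i :: v) j
  have h1 : injSum (subtreeSolid D v) m =
      injSum (fun p : Option ι × List ι => G p.1 p.2) m := by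
    rw [← injSum_comp_of_support (unsnocEmbedding ι) _ m hm]
    · congr 1
      funext w
      rcases w.eq_nil_or_concat with rfl | ⟨t, i, rfl⟩
      · simp [unsnocEmbedding_nil, G, subtreeSolid_nil]
      · simp [unsnocEmbedding_append_singleton, G, subtreeSolid_append_singleton _ _ _ _ (hD _)]
    · rintro ⟨_ | i, j⟩ hp
      · refine ⟨[], ?_⟩
        by_contra hj
        exact hp (if_neg fun h => hj (Prod.ext rfl h.symm))
      · exact ⟨j ++ [i], unsnocEmbedding_append_singleton j i⟩
  rw [h1, injSum_prod]
  refine Finset.sum_congr rfl fun f _ => ?_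
  rw [Fintype.prod_option, Fintype.prod_option]
  simp only [G, injSum_smul, injSum_single _ _ _ fun b : {b // f b = none} => hm b,
    Finset.prod_mul_distrib]
  split_ifs
  · ring
  · simp

variable {Ω : Type*} {mΩ : MeasurableSpace Ω}

theorem measurable_solidSize {mΩ' : MeasurableSpace Ω} {D : List ι → Ω → Option ι → ℝ}
    (hD : ∀ u k, Measurable fun ω => D u ω k) (w : List ι) :
    Measurable fun ω => solidSize (fun u => D u ω) w := by
  have h : ∀ w, Measurable fun ω => crumbSize (fun u => D u ω) w := by
    intro w
    induction w with
    | nil => exact measurable_const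
    | cons i w ih => exact ih.mul (hD _ _)
  exact (h w).mul (hD _ _)

theorem measurable_injSum {B J : Type*} [Fintype B] [Countable J] {mΩ' : MeasurableSpace Ω}
    {x : Ω → J → ℝ≥0∞} (hx : ∀ j, Measurable fun ω => x ω j) (m : B → ℕ) :
    Measurable fun ω => injSum (x ω) m := by
  have : Countable (B ↪ J) := DFunLike.coe_injective.countable
  exact Measurable.tsum fun c => Finset.measurable_prod _ fun b _ => (hx _).pow_const _

/-- The sharp `σ`-algebra, generated by the nodes with suffix `v`, is what makes independence of
different subtrees available. -/
theorem measurable_injSum_subtreeSolid [Countable ι] {B : Type*} [Fintype B]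
    (D : List ι → Ω → Option ι → ℝ) (v : List ι) (m : B → ℕ) :
    Measurable[⨆ u ∈ Set.range (· ++ v), MeasurableSpace.comap (D u) inferInstance]
      fun ω => injSum (subtreeSolid (fun u => D u ω) v) m := by
  refine measurable_injSum (fun w => ENNReal.measurable_ofReal.comp ?_) m
  refine measurable_solidSize (D := fun u => D (u ++ v)) (fun u k => ?_) w
  have h1 : Measurable[⨆ u ∈ Set.range (· ++ v), MeasurableSpace.comap (D u) inferInstance]
      (D (u ++ v)) :=
    measurable_iff_comap_le.2 (le_iSup₂_of_le (u ++ v) ⟨u, rfl⟩ le_rfl)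
  exact (measurable_pi_apply k).comp h1

/-- Functions of disjoint groups of independent random variables are independent. -/
theorem lintegral_prod_of_disjoint_groups {T K : Type*} {μ : Measure Ω} [IsProbabilityMeasure μ]
    {m : T → MeasurableSpace Ω} (hle : ∀ t, m t ≤ mΩ) (hindep : iIndep m μ) (S : K → Set T)
    (hS : Pairwise (Function.onFun Disjoint S)) (F : K → Ω → ℝ≥0∞)
    (hF : ∀ k, Measurable[⨆ t ∈ S k, m t] (F k)) (s : Finset K) :
    ∫⁻ ω, ∏ k ∈ s, F k ω ∂μ = ∏ k ∈ s, ∫⁻ ω, F k ω ∂μ := by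
  classical
  induction s using Finset.induction_on with
  | empty => simp
  | insert k s hk ih =>
    simp only [Finset.prod_insert hk]
    rw [← ih]
    have hdisj : Disjoint (S k) (⋃ k' ∈ s, S k') := by
      rw [Set.disjoint_iUnion₂_right]
      exact fun k' hk' => hS fun h => hk (h ▸ hk')
    refine lintegral_mul_eq_lintegral_mul_lintegral_of_independent_measurableSpace
      (iSup₂_le fun t _ => hle t) (iSup₂_le fun t _ => hle t)
      (indep_iSup_of_disjoint hle hindep hdisj) (hF k) ?_
    refine Finset.measurable_prod _ fun k' hk' => (hF k').mono ?_ le_rfl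
    exact iSup₂_le fun t ht => le_iSup₂_of_le t (Set.mem_biUnion hk' ht) le_rfl

/-- `D` is a random splitting scheme: independent nodes, the pieces of node `v` having the mixed
moments of the Dirichlet distribution with parameters `τ (i :: v)` and `1 - α`. -/
structure IsSplittingScheme [Fintype ι] (μ : Measure Ω) (α : ℝ) (τ : List ι → ℝ)
    (D : List ι → Ω → Option ι → ℝ) : Prop where
  measurable : ∀ v, Measurable (D v)
  indep : iIndepFun D μ
  nonneg : ∀ v, ∀ᵐ ω ∂μ, ∀ k, 0 ≤ D v ω k
  sum_eq_one : ∀ v, ∀ᵐ ω ∂μ, ∑ k, D v ω k = 1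
  moment : ∀ v (r : Option ι → ℕ), ∫⁻ ω, ∏ k, ENNReal.ofReal (D v ω k) ^ r k ∂μ =
    ENNReal.ofReal (dirichletMoment (splitParam α fun i => τ (i :: v)) r)
  pos : ∀ v, 0 < τ v
  sum_param : ∀ v, ∑ i, τ (i :: v) = τ v + α

/-- The probability that the balls form a partition into blocks `b` of sizes `m b`, when painted
from the solids in the subtree of `v`. -/
noncomputable def blockProb (μ : Measure Ω) (D : List ι → Ω → Option ι → ℝ) (v : List ι)
    {B : Type*} [Fintype B] (m : B → ℕ) : ℝ≥0∞ :=
  ∫⁻ ω, injSum (subtreeSolid (fun u => D u ω) v) m ∂μ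

namespace IsSplittingScheme

variable [Fintype ι] {μ : Measure Ω} {α : ℝ} {τ : List ι → ℝ}
  {D : List ι → Ω → Option ι → ℝ}

theorem ae_nonneg (h : IsSplittingScheme μ α τ D) : ∀ᵐ ω ∂μ, ∀ v k, 0 ≤ D v ω k :=
  ae_all_iff.2 h.nonneg

theorem ae_tsum_le_one (h : IsSplittingScheme μ α τ D) (v : List ι) :
    ∀ᵐ ω ∂μ, ∑' w, subtreeSolid (fun u => D u ω) v w ≤ 1 := by
  filter_upwards [h.ae_nonneg, ae_all_iff.2 h.sum_eq_one] with ω h1 h2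
  exact tsum_subtreeSolid_le_one h1 h2 v

theorem blockProb_le_one [IsProbabilityMeasure μ] (h : IsSplittingScheme μ α τ D) (v : List ι)
    {B : Type*} [Fintype B] (m : B → ℕ) (hm : ∀ b, m b ≠ 0) : blockProb μ D v m ≤ 1 := by
  calc blockProb μ D v m ≤ ∫⁻ _, 1 ∂μ := by
        refine lintegral_mono_ae ?_
        filter_upwards [h.ae_tsum_le_one v] with ω hω
        exact injSum_le_one _ m hm hω
    _ = 1 := by simp

/-- This is the expectation of the pathwise recursion `injSum_subtreeSolid`. The root and the
subtrees of its children involve disjoint sets of independent nodes, so each product of factors has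
a product expectation. -/
theorem blockProb_eq_sum [IsProbabilityMeasure μ] [DecidableEq ι] (h : IsSplittingScheme μ α τ D)
    (v : List ι) {B : Type*} [Fintype B] [DecidableEq B] (m : B → ℕ) (hm : ∀ b, m b ≠ 0) :
    blockProb μ D v m = ∑ f : B → Option ι, if Nat.card {b // f b = none} ≤ 1 then
      ENNReal.ofReal (dirichletMoment (splitParam α fun i => τ (i :: v))
        fun k => ∑ b : {b // f b = k}, m b) *
        ∏ i, blockProb μ D (i :: v) (fun b : {b // f b = some i} => m b) else 0 := by
  have hle : ∀ u, MeasurableSpace.comap (D u) inferInstance ≤ mΩ := fun u =>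
    (h.measurable u).comap_le
  have hle' : ∀ v : List ι,
      (⨆ u ∈ Set.range (· ++ v), MeasurableSpace.comap (D u) inferInstance) ≤ mΩ :=
    fun v => iSup₂_le fun u _ => hle u
  have hXm : ∀ r : Option ι → ℕ, Measurable[MeasurableSpace.comap (D v) inferInstance]
      fun ω => ∏ k, ENNReal.ofReal (D v ω k) ^ r k := fun r => by
    refine Finset.measurable_prod _ fun k _ => Measurable.pow_const ?_ _
    exact ENNReal.measurable_ofReal.comp ((measurable_pi_apply k).comp (comap_measurable _))
  have hIm : ∀ (v : List ι) {B' : Type _} [Fintype B'] (m' : B' → ℕ),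
      Measurable fun ω => injSum (subtreeSolid (fun u => D u ω) v) m' := fun v B' _ m' =>
    (measurable_injSum_subtreeSolid D v m').mono (hle' v) le_rfl
  have h1 : blockProb μ D v m = ∫⁻ ω, ∑ f : B → Option ι, (if Nat.card {b // f b = none} ≤ 1 then
      (∏ k, ENNReal.ofReal (D v ω k) ^ (∑ b : {b // f b = k}, m b)) *
        ∏ i, injSum (subtreeSolid (fun u => D u ω) (i :: v))
          (fun b : {b // f b = some i} => m b) else 0) ∂μ := by
    refine lintegral_congr_ae ?_
    filter_upwards [h.nonneg v] with ω hω
    exact injSum_subtreeSolid (fun u => D u ω) v hω m hm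
  rw [h1, lintegral_finsetSum]
  · refine Finset.sum_congr rfl fun f _ => ?_
    split_ifs with hf
    · let S : Option ι → Set (List ι) := fun k => match k with
        | none => {v}
        | some i => Set.range (· ++ i :: v)
      let F : Option ι → Ω → ℝ≥0∞ := fun k => match k with
        | none => fun ω => ∏ k, ENNReal.ofReal (D v ω k) ^ (∑ b : {b // f b = k}, m b)
        | some i => fun ω => injSum (subtreeSolid (fun u => D u ω) (i :: v))
            (fun b : {b // f b = some i} => m b)
      have hne : ∀ i (u : List ι), u ++ i :: v ≠ v := fun i u hu => by
        have := congrArg List.length hu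
        simp at this
        omega
      have hS : Pairwise (Function.onFun Disjoint S) := by
        intro k k' hk
        rw [Function.onFun, Set.disjoint_left]
        rcases k with _ | i <;> rcases k' with _ | i'
        · exact (hk rfl).elim
        · rintro u hu ⟨u', hu'⟩
          exact hne i' u' (hu'.trans hu)
        · rintro _ ⟨u', rfl⟩ hu
          exact hne i u' hu
        · rintro _ ⟨u, rfl⟩ ⟨u', hu'⟩
          have := (List.append_inj' hu' (by simp)).2
          simp only [List.cons.injEq, and_true] at this
          exact hk (by rw [this])
      have := lintegral_prod_of_disjoint_groups hle h.indep S hS F (fun k => ?_) Finset.univ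
      · rw [Fintype.prod_option] at this
        simp only [Fintype.prod_option (fun k => F k _)] at this
        rw [← h.moment v]
        exact this
      · rcases k with _ | i
        · exact (hXm _).mono (le_iSup₂_of_le v rfl le_rfl) le_rfl
        · exact measurable_injSum_subtreeSolid D (i :: v) _
    · simp
  · intro f _
    split_ifs
    · refine Measurable.mul ((hXm _).mono (hle v) le_rfl) ?_
      exact Finset.measurable_prod _ fun i _ => hIm _ _
    · exact measurable_const

end IsSplittingScheme

end SplittingTree

/-! ### Uniqueness for the recursion: the error tends to zero with depth -/

theorem ascPochhammer_div_le {a b : ℝ} (ha : 0 < a) (hab : a ≤ b) {n : ℕ} (hn : n ≠ 0) :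
    (ascPochhammer ℝ n).eval a / (ascPochhammer ℝ n).eval b ≤ a / b := by
  obtain ⟨n, rfl⟩ := Nat.exists_eq_succ_of_ne_zero hn
  have hb := ha.trans_le hab
  induction n with
  | zero => simp
  | succ n ih =>
    rw [Nat.succ_eq_add_one, ascPochhammer_succ_eval _ a, ascPochhammer_succ_eval _ b,
      mul_div_mul_comm]
    have h1 := ih (Nat.succ_ne_zero n)
    have h2 : (a + ((n + 1 : ℕ) : ℝ)) / (b + ((n + 1 : ℕ) : ℝ)) ≤ 1 := by
      rw [div_le_one (by positivity)]; linarith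
    have h3 := (ascPochhammer_pos (n + 1) a ha).le
    have h4 := (ascPochhammer_pos (n + 1) b hb).le
    calc _ ≤ (ascPochhammer ℝ (n + 1)).eval a / (ascPochhammer ℝ (n + 1)).eval b * 1 := by
          refine mul_le_mul_of_nonneg_left h2 (by positivity)
      _ ≤ _ := by rw [mul_one]; exact h1

theorem dirichletMoment_nonneg {K : Type*} [Fintype K] {a : K → ℝ} (ha : ∀ k, 0 < a k)
    (r : K → ℕ) : 0 ≤ dirichletMoment a r := by
  unfold dirichletMoment
  refine div_nonneg (Finset.prod_nonneg fun k _ => (ascPochhammer_pos _ _ (ha k)).le) ?_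
  rcases isEmpty_or_nonempty K with h | h
  · simp
  · exact (ascPochhammer_pos _ _ (Finset.sum_pos (fun k _ => ha k) Finset.univ_nonempty)).le

/-- This is `E X^n ≤ E X` for a Dirichlet coordinate `X ≤ 1` and `n ≥ 1`. It bounds the coefficient
of the event that all blocks fall into one crumb. -/
theorem dirichletMoment_single_le {K : Type*} [Fintype K] [DecidableEq K] {a : K → ℝ}
    (ha : ∀ k, 0 < a k) (k₀ : K) (r : K → ℕ) (hr : ∀ k ≠ k₀, r k = 0) (h0 : r k₀ ≠ 0) :
    dirichletMoment a r ≤ a k₀ / ∑ k, a k := by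
  unfold dirichletMoment
  rw [Fintype.prod_eq_single k₀ fun k hk => by simp [hr k hk],
    Fintype.sum_eq_single k₀ fun k hk => hr k hk]
  exact ascPochhammer_div_le (ha k₀)
    (Finset.single_le_sum (f := a) (fun k _ => (ha k).le) (Finset.mem_univ k₀)) h0

/-- Use `1 - x ≤ exp (-x)` and compare with the harmonic series: `T + lα + 1 ≤ (T + 1)(l + 1)` since
`α < 1`. -/
theorem tendsto_prod_one_sub_div {α T : ℝ} (hα0 : 0 < α) (hα1 : α < 1) (hT : 0 < T) :
    Filter.Tendsto (fun k => ∏ l ∈ Finset.range k, (1 - (1 - α) / (T + l * α + 1)))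
      Filter.atTop (nhds 0) := by
  have hpos : ∀ l : ℕ, 0 < T + l * α + 1 := fun l => by positivity
  have hc : ∀ l : ℕ, (1 - α) / (T + 1) * (1 / ((l : ℝ) + 1)) ≤ (1 - α) / (T + l * α + 1) := by
    intro l
    rw [mul_one_div, div_div, div_le_div_iff_of_pos_left (by linarith) (by positivity) (hpos l)]
    have : (0 : ℝ) ≤ l := Nat.cast_nonneg l
    nlinarith
  have hle : ∀ k, ∏ l ∈ Finset.range k, (1 - (1 - α) / (T + l * α + 1)) ≤
      Real.exp (-((1 - α) / (T + 1) * ∑ l ∈ Finset.range k, 1 / ((l : ℝ) + 1))) := by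
    intro k
    rw [Finset.mul_sum, ← Finset.sum_neg_distrib, Real.exp_sum]
    refine Finset.prod_le_prod (fun l _ => ?_) fun l _ => ?_
    · rw [sub_nonneg, div_le_one (hpos l)]
      have : (0 : ℝ) ≤ l * α := by positivity
      linarith
    · calc 1 - (1 - α) / (T + l * α + 1) ≤ -((1 - α) / (T + 1) * (1 / ((l : ℝ) + 1))) + 1 := by
            linarith [hc l]
        _ ≤ _ := Real.add_one_le_exp _
  refine squeeze_zero (fun k => Finset.prod_nonneg fun l _ => ?_) hle ?_
  · rw [sub_nonneg, div_le_one (hpos l)]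
    have : (0 : ℝ) ≤ l * α := by positivity
    linarith
  · refine Real.tendsto_exp_neg_atTop_nhds_zero.comp ?_
    have : 0 < (1 - α) / (T + 1) := div_pos (by linarith) (by linarith)
    exact Real.tendsto_sum_range_one_div_nat_succ_atTop.const_mul_atTop this

theorem splitParam_pos {ι : Type*} {α : ℝ} (hα1 : α < 1) {τ : ι → ℝ} (hτ : ∀ i, 0 < τ i)
    (k : Option ι) :
    0 < splitParam α τ k := by
  rcases k with _ | i
  · exact sub_pos.2 hα1
  · exact hτ i

theorem ewensPitmanBlocks_equiv {B B' : Type*} [Fintype B] [Fintype B'] (e : B' ≃ B) (α θ : ℝ)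
    (m : B → ℕ) : ewensPitmanBlocks α θ (fun b => m (e b)) = ewensPitmanBlocks α θ m := by
  unfold ewensPitmanBlocks
  rw [Nat.card_congr e, e.sum_comp, e.prod_comp fun b => (ascPochhammer ℝ (m b - 1)).eval (1 - α)]

theorem ewensPitmanBlocks_of_isEmpty {B : Type*} [Fintype B] [IsEmpty B] (α θ : ℝ) (m : B → ℕ) :
    ewensPitmanBlocks α θ m = 1 := by
  simp [ewensPitmanBlocks]

theorem blockProb_equiv {ι Ω : Type*} {mΩ : MeasurableSpace Ω} (μ : Measure Ω)
    (D : List ι → Ω → Option ι → ℝ) (v : List ι) {B B' : Type*} [Fintype B] [Fintype B']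
    (e : B' ≃ B) (m : B → ℕ) : blockProb μ D v (fun b => m (e b)) = blockProb μ D v m :=
  lintegral_congr fun _ => injSum_equiv e _ m

theorem blockProb_of_isEmpty {ι Ω : Type*} {mΩ : MeasurableSpace Ω} (μ : Measure Ω)
    [IsProbabilityMeasure μ] (D : List ι → Ω → Option ι → ℝ) (v : List ι) {B : Type*} [Fintype B]
    [IsEmpty B] (m : B → ℕ) : blockProb μ D v m = 1 := by
  simp [blockProb, injSum_of_isEmpty]

namespace IsSplittingScheme

variable {ι : Type*} [Fintype ι] {Ω : Type*} {mΩ : MeasurableSpace Ω} {μ : Measure Ω}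
  {α : ℝ} {τ : List ι → ℝ} {D : List ι → Ω → Option ι → ℝ}

theorem sum_splitParam (h : IsSplittingScheme μ α τ D) (v : List ι) :
    ∑ k, splitParam α (fun i => τ (i :: v)) k = τ v + 1 := by
  rw [Fintype.sum_option]
  simp only [splitParam]
  rw [h.sum_param]
  ring

/-- If the formula for block probabilities holds for fewer blocks, then the error at a node is at
most the average of the errors at its children. -/
theorem error_le_sum [IsProbabilityMeasure μ] (h : IsSplittingScheme μ α τ D) (hα1 : α < 1)
    (v : List ι) {B : Type*}
    [Fintype B] [Nonempty B] (m : B → ℕ) (hm : ∀ b, m b ≠ 0)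
    (ih : ∀ (s : B → Prop) [DecidablePred s] (v : List ι), Nat.card {b // s b} < Nat.card B →
      (blockProb μ D v fun b : {b // s b} => m b).toReal =
        ewensPitmanBlocks α (τ v) fun b : {b // s b} => m b) :
    |(blockProb μ D v m).toReal - ewensPitmanBlocks α (τ v) m| ≤
      ∑ i, τ (i :: v) / (τ v + 1) *
        |(blockProb μ D (i :: v) m).toReal - ewensPitmanBlocks α (τ (i :: v)) m| := by
  classical
  have hpar := splitParam_pos hα1 fun i => h.pos (i :: v)
  have hfin : ∀ (v : List ι) (s : B → Prop) [DecidablePred s],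
      (blockProb μ D v fun b : {b // s b} => m b) ≠ ∞ := fun v s _ =>
    ((h.blockProb_le_one v (fun b : {b // s b} => m b) fun b => hm b).trans_lt
      ENNReal.one_lt_top).ne
  let M : (B → Option ι) → ℝ := fun f => dirichletMoment (splitParam α fun i => τ (i :: v))
    fun k => ∑ b : {b // f b = k}, m b
  let Δ : (B → Option ι) → ℝ := fun f => if Nat.card {b // f b = none} ≤ 1 then M f *
    (∏ i, (blockProb μ D (i :: v) fun b : {b // f b = some i} => m b).toReal -
      ∏ i, ewensPitmanBlocks α (τ (i :: v)) fun b : {b // f b = some i} => m b) else 0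
  have hdiff : (blockProb μ D v m).toReal - ewensPitmanBlocks α (τ v) m = ∑ f, Δ f := by
    rw [h.blockProb_eq_sum v m hm, ewensPitmanBlocks_eq_sum (h.pos v) (fun i => h.pos (i :: v))
      (h.sum_param v) m hm, ENNReal.toReal_sum, ← Finset.sum_sub_distrib]
    · refine Finset.sum_congr rfl fun f _ => ?_
      simp only [Δ]
      split_ifs
      · rw [ENNReal.toReal_mul, ENNReal.toReal_prod,
          ENNReal.toReal_ofReal (dirichletMoment_nonneg hpar _), mul_sub]
      · simp
    · intro f _
      split_ifs
      · exact ENNReal.mul_ne_top ENNReal.ofReal_ne_top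
          (ENNReal.prod_ne_top fun i _ => hfin _ _)
      · simp
  have hconst : Function.Injective fun (i : ι) (_ : B) => some i := fun i i' hi =>
    Option.some.inj (congrFun hi (Classical.arbitrary B))
  -- Unless `f` sends every block to the same crumb, each crumb receives fewer blocks than `B`, and
  -- the induction hypothesis makes the two products equal.
  have hzero : ∀ f, f ∉ Finset.univ.image (fun (i : ι) (_ : B) => some i) → Δ f = 0 := by
    intro f hf
    simp only [Δ]
    split_ifs with hn
    · refine mul_eq_zero_of_right _ (sub_eq_zero.2 (Finset.prod_congr rfl fun i _ => ?_))
      refine ih (fun b => f b = some i) (i :: v) ?_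
      have hb : ∃ b, f b ≠ some i := by
        by_contra! hcon
        exact hf (Finset.mem_image.2 ⟨i, Finset.mem_univ i, (funext hcon).symm⟩)
      exact Finite.card_subtype_lt hb.choose_spec
    · rfl
  rw [hdiff, ← Finset.sum_subset (Finset.subset_univ _) fun f _ hf => hzero f hf,
    Finset.sum_image fun i _ i' _ hi => hconst hi]
  refine (Finset.abs_sum_le_sum_abs _ _).trans (Finset.sum_le_sum fun i _ => ?_)
  have hempty : ∀ k ≠ some i, IsEmpty {_b : B // some i = k} := fun k hk =>
    ⟨fun b => hk b.2.symm⟩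
  have hn : Nat.card {_b : B // some i = none} ≤ 1 := by
    have := hempty none (by simp)
    simp
  let e : {_b : B // some i = some i} ≃ B := Equiv.subtypeUnivEquiv fun _ => rfl
  have e1 : (blockProb μ D (i :: v) fun b : {_b : B // some i = some i} => m b) =
    blockProb μ D (i :: v) m := blockProb_equiv μ D _ e m
  have e2 : (ewensPitmanBlocks α (τ (i :: v)) fun b : {_b : B // some i = some i} => m b) =
    ewensPitmanBlocks α (τ (i :: v)) m := ewensPitmanBlocks_equiv e α _ m
  simp only [Δ]
  rw [if_pos hn, Fintype.prod_eq_single i, Fintype.prod_eq_single i, e1, e2, abs_mul,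
    abs_of_nonneg (dirichletMoment_nonneg hpar _)]
  · refine mul_le_mul_of_nonneg_right ?_ (abs_nonneg _)
    rw [← h.sum_splitParam v]
    refine dirichletMoment_single_le hpar (some i) _ (fun k hk => ?_) ?_
    · have := hempty k hk
      simp
    · have e3 : ∑ b : {_b : B // some i = some i}, m b = ∑ b, m b := e.sum_comp m
      rw [e3]
      exact (Finset.sum_pos (fun b _ => Nat.pos_of_ne_zero (hm b)) Finset.univ_nonempty).ne'
  · intro i' hi'
    have := hempty (some i') (by simpa using hi')
    exact ewensPitmanBlocks_of_isEmpty _ _ _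
  · intro i' hi'
    have := hempty (some i') (by simpa using hi')
    rw [blockProb_of_isEmpty, ENNReal.toReal_one]

/-- This is `error_le_sum` unrolled over `k` generations. An upper bound `T` replaces `τ v` so that
the induction closes: a child has parameter at most `τ v + α ≤ T + α`. -/
theorem error_le_prod [IsProbabilityMeasure μ] (h : IsSplittingScheme μ α τ D) (hα0 : 0 < α)
    (hα1 : α < 1) {B : Type*} [Fintype B] [Nonempty B] (m : B → ℕ) (hm : ∀ b, m b ≠ 0)
    (ih : ∀ (s : B → Prop) [DecidablePred s] (v : List ι), Nat.card {b // s b} < Nat.card B →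
      (blockProb μ D v fun b : {b // s b} => m b).toReal =
        ewensPitmanBlocks α (τ v) fun b : {b // s b} => m b) (k : ℕ) :
    ∀ (v : List ι) (T : ℝ), 0 < T → τ v ≤ T →
    |(blockProb μ D v m).toReal - ewensPitmanBlocks α (τ v) m| ≤
      (1 + ∏ b, (ascPochhammer ℝ (m b - 1)).eval (1 - α)) *
        ∏ l ∈ Finset.range k, (1 - (1 - α) / (T + l * α + 1)) := by
  have hC : 0 ≤ ∏ b, (ascPochhammer ℝ (m b - 1)).eval (1 - α) :=
    Finset.prod_nonneg fun b _ => (ascPochhammer_pos _ _ (sub_pos.2 hα1)).le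
  induction k with
  | zero =>
    intro v T hT hv
    rw [Finset.prod_range_zero, mul_one, abs_le]
    have h1 : (blockProb μ D v m).toReal ≤ 1 :=
      ENNReal.toReal_le_of_le_ofReal zero_le_one (by simpa using h.blockProb_le_one v m hm)
    have h2 : 0 ≤ (blockProb μ D v m).toReal := ENNReal.toReal_nonneg
    have h3 := ewensPitmanBlocks_nonneg hα0 hα1 (h.pos v) m
    have h4 := ewensPitmanBlocks_le hα0 hα1 (h.pos v) m hm
    constructor <;> linarith
  | succ k ihk =>
    intro v T hT hv
    have hτ := h.pos v
    set E := (1 + ∏ b, (ascPochhammer ℝ (m b - 1)).eval (1 - α)) *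
      ∏ l ∈ Finset.range k, (1 - (1 - α) / (T + α + l * α + 1)) with hE
    have hE0 : 0 ≤ E := by
      refine mul_nonneg (by linarith) (Finset.prod_nonneg fun l _ => ?_)
      have : (0 : ℝ) ≤ l * α := by positivity
      rw [sub_nonneg, div_le_one (by linarith)]
      linarith
    have hchild : ∀ i, |(blockProb μ D (i :: v) m).toReal -
        ewensPitmanBlocks α (τ (i :: v)) m| ≤ E := fun i => by
      refine ihk (i :: v) (T + α) (by linarith) ?_
      have := Finset.single_le_sum (f := fun i => τ (i :: v)) (fun i _ => (h.pos (i :: v)).le)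
        (Finset.mem_univ i)
      rw [h.sum_param v] at this
      linarith
    calc _ ≤ ∑ i, τ (i :: v) / (τ v + 1) * E := by
          refine (h.error_le_sum hα1 v m hm ih).trans (Finset.sum_le_sum fun i _ => ?_)
          exact mul_le_mul_of_nonneg_left (hchild i)
            (div_nonneg (h.pos _).le (by linarith))
      _ = (1 - (1 - α) / (τ v + 1)) * E := by
          rw [← Finset.sum_mul, ← Finset.sum_div, h.sum_param]
          field_simp
          ring
      _ ≤ (1 - (1 - α) / (T + 1)) * E := by
          refine mul_le_mul_of_nonneg_right ?_ hE0
          have : (1 - α) / (T + 1) ≤ (1 - α) / (τ v + 1) :=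
            div_le_div_of_nonneg_left (by linarith) (by linarith) (by linarith)
          linarith
      _ = _ := by
          -- The new factor is the one with `l = 0`; replacing `T` by `T + α` shifts the index of
          -- the others by one.
          rw [Finset.prod_range_succ', hE]
          have : ∀ l : ℕ, T + ((l + 1 : ℕ) : ℝ) * α + 1 = T + α + l * α + 1 := fun l => by
            push_cast; ring
          simp only [this, Nat.cast_zero, zero_mul, add_zero]
          ring

/-- The block probabilities of a splitting scheme are the Ewens–Pitman ones. -/
theorem blockProb_toReal [IsProbabilityMeasure μ] (h : IsSplittingScheme μ α τ D) (hα0 : 0 < α)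
    (hα1 : α < 1) {B : Type*} [Fintype B] (m : B → ℕ) (hm : ∀ b, m b ≠ 0) (v : List ι) :
    (blockProb μ D v m).toReal = ewensPitmanBlocks α (τ v) m := by
  induction hn : Nat.card B using Nat.strong_induction_on generalizing B v with
  | _ n ih =>
    rcases isEmpty_or_nonempty B with hB | hB
    · rw [blockProb_of_isEmpty, ewensPitmanBlocks_of_isEmpty, ENNReal.toReal_one]
    -- The bound holds for every depth `k` and tends to `0`, so the error at `v` is zero.
    · have hlim := (tendsto_prod_one_sub_div hα0 hα1 (h.pos v)).const_mul
        (1 + ∏ b, (ascPochhammer ℝ (m b - 1)).eval (1 - α))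
      rw [mul_zero] at hlim
      have hle := ge_of_tendsto' hlim fun k => h.error_le_prod hα0 hα1 m hm
        (fun s _ v hs => ih _ (hn ▸ hs) (fun b : {b // s b} => m b)
          (fun b => hm b) v rfl) k v (τ v) (h.pos v) le_rfl
      exact sub_eq_zero.1 (abs_nonpos_iff.1 hle)

theorem blockProb_eq [IsProbabilityMeasure μ] (h : IsSplittingScheme μ α τ D) (hα0 : 0 < α)
    (hα1 : α < 1) {B : Type*} [Fintype B] (m : B → ℕ) (hm : ∀ b, m b ≠ 0) (v : List ι) :
    blockProb μ D v m = ENNReal.ofReal (ewensPitmanBlocks α (τ v) m) := by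
  rw [← h.blockProb_toReal hα0 hα1 m hm v, ENNReal.ofReal_toReal]
  exact ((h.blockProb_le_one v m hm).trans_lt ENNReal.one_lt_top).ne

/-- For one block of size `1` the block probability is the expected total mass of the solids, and
the formula gives `θ/θ = 1`. A total that is at most `1` with mean `1` equals `1` almost surely. -/
theorem ae_hasSum [IsProbabilityMeasure μ] (h : IsSplittingScheme μ α τ D) (hα0 : 0 < α)
    (hα1 : α < 1) : ∀ᵐ ω ∂μ, (∀ w, 0 ≤ solidSize (fun v => D v ω) w) ∧
      HasSum (solidSize fun v => D v ω) 1 := by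
  have hsub : ∀ ω w, subtreeSolid (fun u => D u ω) [] w =
      ENNReal.ofReal (solidSize (fun v => D v ω) w) := fun ω w => by simp [subtreeSolid]
  have hone : ∫⁻ ω, ∑' w, subtreeSolid (fun u => D u ω) [] w ∂μ = 1 := by
    have h1 := h.blockProb_eq hα0 hα1 (fun _ : Unit => 1) (fun _ => one_ne_zero) []
    simp only [blockProb, injSum_unit] at h1
    rw [h1]
    simp [ewensPitmanBlocks, (h.pos []).ne']
  have heq : (fun ω => ∑' w, subtreeSolid (fun u => D u ω) [] w) =ᵐ[μ] fun _ => 1 := by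
    refine ae_eq_of_ae_le_of_lintegral_le (h.ae_tsum_le_one []) ?_ aemeasurable_const ?_
    · rw [hone]; simp
    · rw [hone]; simp
  filter_upwards [h.ae_nonneg, heq] with ω h1 h2
  have hnn := solidSize_nonneg h1
  refine ⟨hnn, ?_⟩
  simp only [hsub] at h2
  have h3 : ∑' w, ENNReal.ofReal (solidSize (fun v => D v ω) w) ≠ ∞ := by simp [h2]
  have h4 := ENNReal.hasSum_toReal h3
  rw [← ENNReal.tsum_toReal_eq fun w => ENNReal.ofReal_ne_top, h2, ENNReal.toReal_one] at h4
  simpa only [ENNReal.toReal_ofReal (hnn _)] using h4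

end IsSplittingScheme

/-! ### Mixed moments of the gamma, Dirichlet and beta laws -/

theorem Gamma_add_natCast {a : ℝ} (ha : 0 < a) (n : ℕ) :
    Real.Gamma (a + n) = (ascPochhammer ℝ n).eval a * Real.Gamma a := by
  induction n with
  | zero => simp
  | succ n ih =>
    rw [Nat.cast_succ, ← add_assoc, Real.Gamma_add_one (by positivity), ih,
      ascPochhammer_succ_eval]
    ring

theorem lintegral_rpow_mul_exp {p S : ℝ} (hp : 0 < p) (hS : 0 < S) :
    ∫⁻ t in Set.Ioi 0, ENNReal.ofReal (t ^ (p - 1) * Real.exp (-(S * t))) =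
      ENNReal.ofReal (Real.Gamma p * S ^ (-p)) := by
  have hint : ∫ t in Set.Ioi 0, t ^ (p - 1) * Real.exp (-(S * t)) = Real.Gamma p * S ^ (-p) := by
    rw [Real.integral_rpow_mul_exp_neg_mul_Ioi hp hS, one_div, Real.inv_rpow hS.le,
      Real.rpow_neg hS.le, mul_comm]
  have hpos : 0 < Real.Gamma p * S ^ (-p) :=
    mul_pos (Real.Gamma_pos_of_pos hp) (Real.rpow_pos_of_pos hS _)
  rw [← hint, ofReal_integral_eq_lintegral_ofReal]
  · by_contra hni
    rw [integral_undef hni] at hint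
    exact hpos.ne hint
  · refine (ae_restrict_iff' measurableSet_Ioi).2 (ae_of_all _ fun t ht => ?_)
    exact mul_nonneg (Real.rpow_nonneg (le_of_lt ht) _) (Real.exp_pos _).le

theorem ae_gammaMeasure_pos (a : ℝ) : ∀ᵐ x ∂gammaMeasure a 1, 0 < x := by
  have hm : Measurable (gammaPDF a 1) := (measurable_gammaPDFReal a 1).ennreal_ofReal
  rw [gammaMeasure, ae_withDensity_iff hm]
  filter_upwards [Measure.ae_ne volume (0 : ℝ)] with x hx hne
  rcases lt_or_gt_of_ne hx with h | h
  · exact (hne (gammaPDF_of_neg h)).elim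
  · exact h

theorem lintegral_gammaMeasure (a : ℝ) (f : ℝ → ℝ≥0∞) (hf : Measurable f) :
    ∫⁻ x, f x ∂gammaMeasure a 1 = ∫⁻ x in Set.Ioi 0, ENNReal.ofReal (1 / Real.Gamma a) *
      (ENNReal.ofReal (x ^ (a - 1) * Real.exp (-x)) * f x) := by
  have hm : Measurable (gammaPDF a 1) := (measurable_gammaPDFReal a 1).ennreal_ofReal
  rw [gammaMeasure, lintegral_withDensity_eq_lintegral_mul _ hm hf,
    ← lintegral_indicator measurableSet_Ioi]
  refine lintegral_congr_ae ?_
  filter_upwards [Measure.ae_ne volume (0 : ℝ)] with x hx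
  rcases lt_or_gt_of_ne hx with h | h
  · rw [Set.indicator_of_notMem (by simpa using h.le), Pi.mul_apply, gammaPDF_of_neg h, zero_mul]
  · rw [Set.indicator_of_mem (Set.mem_Ioi.2 h), Pi.mul_apply, gammaPDF_of_nonneg h.le, ← mul_assoc,
      ← ENNReal.ofReal_mul' (by positivity), Real.one_rpow, one_mul, mul_assoc]

theorem lintegral_pow_mul_exp_gammaMeasure {a t : ℝ} (ha : 0 < a) (ht : 0 ≤ t) (n : ℕ) :
    ∫⁻ x, ENNReal.ofReal x ^ n * ENNReal.ofReal (Real.exp (-(t * x))) ∂gammaMeasure a 1 =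
      ENNReal.ofReal ((ascPochhammer ℝ n).eval a * (1 + t) ^ (-(a + n))) := by
  rw [lintegral_gammaMeasure a _ (by fun_prop), lintegral_const_mul _ (by fun_prop)]
  have h : ∫⁻ x in Set.Ioi 0, ENNReal.ofReal (x ^ (a - 1) * Real.exp (-x)) *
      (ENNReal.ofReal x ^ n * ENNReal.ofReal (Real.exp (-(t * x)))) =
      ∫⁻ x in Set.Ioi 0, ENNReal.ofReal (x ^ (a + n - 1) * Real.exp (-((1 + t) * x))) := by
    refine setLIntegral_congr_fun measurableSet_Ioi fun x (hx : 0 < x) => ?_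
    rw [← ENNReal.ofReal_pow hx.le, ← ENNReal.ofReal_mul (by positivity),
      ← ENNReal.ofReal_mul (by positivity)]
    congr 1
    rw [show a + n - 1 = a - 1 + n by ring, Real.rpow_add hx, Real.rpow_natCast,
      show -((1 + t) * x) = -x + -(t * x) by ring, Real.exp_add]
    ring
  have hG := Real.Gamma_pos_of_pos ha
  rw [h, lintegral_rpow_mul_exp (by positivity) (by positivity),
    ← ENNReal.ofReal_mul (by positivity), Gamma_add_natCast ha]
  congr 1
  field_simp

/-- Write `Γ(A+p) (1+t)^(-(A+p))` as `∫ s^(A+p-1) exp (-(1+t)s) ds` and exchange the integrals. -/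
theorem lintegral_rpow_mul_one_add_rpow {p A : ℝ} (hp : 0 < p) (hA : 0 < A) :
    ∫⁻ t in Set.Ioi 0, ENNReal.ofReal (t ^ (p - 1) * (1 + t) ^ (-(A + p))) =
      ENNReal.ofReal (Real.Gamma p * Real.Gamma A / Real.Gamma (A + p)) := by
  have hG := Real.Gamma_pos_of_pos (add_pos hA hp)
  have hGp := Real.Gamma_pos_of_pos hp
  have hGA := Real.Gamma_pos_of_pos hA
  have h1 : ∫⁻ t in Set.Ioi 0, ENNReal.ofReal (Real.Gamma (A + p)) *
      ENNReal.ofReal (t ^ (p - 1) * (1 + t) ^ (-(A + p))) =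
      ∫⁻ t in Set.Ioi 0, ∫⁻ s in Set.Ioi 0, ENNReal.ofReal (s ^ (A + p - 1) * Real.exp (-s)) *
        ENNReal.ofReal (t ^ (p - 1) * Real.exp (-(s * t))) := by
    refine setLIntegral_congr_fun measurableSet_Ioi fun t (ht : 0 < t) => ?_
    rw [← ENNReal.ofReal_mul hG.le, mul_left_comm, ENNReal.ofReal_mul (by positivity),
      ← lintegral_rpow_mul_exp (by positivity) (by positivity),
      ← lintegral_const_mul _ (by fun_prop)]
    refine setLIntegral_congr_fun measurableSet_Ioi fun s (hs : 0 < s) => ?_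
    rw [← ENNReal.ofReal_mul (by positivity), ← ENNReal.ofReal_mul (by positivity),
      show -((1 + t) * s) = -s + -(s * t) by ring, Real.exp_add]
    congr 1
    ring
  have h2 : ∫⁻ s in Set.Ioi 0, ∫⁻ t in Set.Ioi 0,
      ENNReal.ofReal (s ^ (A + p - 1) * Real.exp (-s)) *
        ENNReal.ofReal (t ^ (p - 1) * Real.exp (-(s * t))) =
      ∫⁻ s in Set.Ioi 0, ENNReal.ofReal (Real.Gamma p) *
        ENNReal.ofReal (s ^ (A - 1) * Real.exp (-(1 * s))) := by
    refine setLIntegral_congr_fun measurableSet_Ioi fun s (hs : 0 < s) => ?_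
    rw [lintegral_const_mul _ (by fun_prop), lintegral_rpow_mul_exp hp hs,
      ← ENNReal.ofReal_mul (by positivity), ← ENNReal.ofReal_mul (by positivity),
      show A - 1 = A + p - 1 + -p by ring, Real.rpow_add hs, one_mul]
    congr 1
    ring
  rw [lintegral_const_mul _ (by fun_prop), lintegral_lintegral_swap (by fun_prop), h2,
    lintegral_const_mul _ (by fun_prop), lintegral_rpow_mul_exp hA one_pos] at h1
  rw [mul_div_assoc, ENNReal.ofReal_mul hGp.le, ENNReal.ofReal_div_of_pos hG]
  rw [Real.one_rpow, mul_one] at h1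
  rw [← mul_div_assoc, ENNReal.eq_div_iff (by simpa using hG) ENNReal.ofReal_ne_top, h1]

theorem lintegral_pi_prod {K : Type*} [Fintype K] {X : K → Type*} [∀ k, MeasurableSpace (X k)]
    (ν : ∀ k, Measure (X k)) [∀ k, IsProbabilityMeasure (ν k)] (f : ∀ k, X k → ℝ≥0∞)
    (hf : ∀ k, Measurable (f k)) :
    ∫⁻ x, ∏ k, f k (x k) ∂Measure.pi ν = ∏ k, ∫⁻ x, f k x ∂ν k := by
  rw [lintegral_prod_eq_prod_lintegral_of_indepFun Finset.univ (fun k (x : ∀ k, X k) => f k (x k))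
    (iIndepFun_pi fun k => (hf k).aemeasurable) fun k => (hf k).comp (measurable_pi_apply k)]
  exact Finset.prod_congr rfl fun k _ =>
    (measurePreserving_eval ν k).lintegral_comp (hf k)

theorem ae_pi_gammaMeasure_pos {K : Type*} [Fintype K] {a : K → ℝ} (ha : ∀ k, 0 < a k) :
    ∀ᵐ g ∂Measure.pi fun k => gammaMeasure (a k) 1, ∀ k, 0 < g k := by
  have : ∀ k, IsProbabilityMeasure (gammaMeasure (a k) 1) := fun k =>
    isProbabilityMeasure_gammaMeasure (ha k) one_pos
  exact ae_all_iff.2 fun k =>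
    (Measure.quasiMeasurePreserving_eval _ k).ae (ae_gammaMeasure_pos (a k))

theorem measurable_normalize {K : Type*} [Fintype K] :
    Measurable fun (g : K → ℝ) (k : K) => g k / ∑ j, g j := by
  fun_prop

theorem ae_dirichletMeasure {K : Type*} [Fintype K] [Nonempty K] {a : K → ℝ}
    (ha : ∀ k, 0 < a k) :
    ∀ᵐ x ∂dirichletMeasure a, (∀ k, 0 ≤ x k) ∧ ∑ k, x k = 1 := by
  rw [dirichletMeasure, ae_map_iff measurable_normalize.aemeasurable]
  · filter_upwards [ae_pi_gammaMeasure_pos ha] with g hg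
    have hS : 0 < ∑ j, g j := Finset.sum_pos (fun k _ => hg k) Finset.univ_nonempty
    refine ⟨fun k => div_nonneg (hg k).le hS.le, ?_⟩
    rw [← Finset.sum_div, div_self hS.ne']
  · measurability

/-- The normalization is decoupled by `Γ(M) S^(-M) = ∫ t^(M-1) exp (-S t) dt` with `S = ∑ g j`: for
fixed `t` the integrand is a product over the independent gamma variables. What remains is a beta
integral in `t`. -/
theorem lintegral_dirichletMeasure {K : Type*} [Fintype K] {a : K → ℝ}
    (ha : ∀ k, 0 < a k) (r : K → ℕ) :
    ∫⁻ x, ∏ k, ENNReal.ofReal (x k) ^ r k ∂dirichletMeasure a =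
      ENNReal.ofReal (dirichletMoment a r) := by
  have hprob : ∀ k, IsProbabilityMeasure (gammaMeasure (a k) 1) := fun k =>
    isProbabilityMeasure_gammaMeasure (ha k) one_pos
  rw [dirichletMeasure, lintegral_map (by fun_prop) measurable_normalize]
  -- The gamma integral needs `M > 0`, so the trivial moment is treated apart.
  rcases eq_or_ne (∑ k, r k) 0 with hM | hM
  · have hr : ∀ k, r k = 0 := by simpa using hM
    simp [dirichletMoment, hr]
  obtain ⟨k₀, -, -⟩ := Finset.exists_ne_zero_of_sum_ne_zero hM
  have : Nonempty K := ⟨k₀⟩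
  set M := ∑ k, r k
  set A := ∑ k, a k
  have hA : 0 < A := Finset.sum_pos (fun k _ => ha k) Finset.univ_nonempty
  have hM0 : (0 : ℝ) < M := by exact_mod_cast Nat.pos_of_ne_zero hM
  have hG := Real.Gamma_pos_of_pos hM0
  have h1 : ∫⁻ g, ENNReal.ofReal (Real.Gamma M) * ∏ k, ENNReal.ofReal (g k / ∑ j, g j) ^ r k
      ∂(Measure.pi fun k => gammaMeasure (a k) 1) =
      ∫⁻ g, (∫⁻ t in Set.Ioi (0 : ℝ), ENNReal.ofReal (t ^ ((M : ℝ) - 1)) *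
        ∏ k, (ENNReal.ofReal (g k) ^ r k * ENNReal.ofReal (Real.exp (-(t * g k)))))
      ∂(Measure.pi fun k => gammaMeasure (a k) 1) := by
    refine lintegral_congr_ae ?_
    filter_upwards [ae_pi_gammaMeasure_pos ha] with g hg
    have hS : 0 < ∑ j, g j := Finset.sum_pos (fun k _ => hg k) Finset.univ_nonempty
    have e1 : ∀ t : ℝ, 0 < t → ENNReal.ofReal (t ^ ((M : ℝ) - 1)) *
        ∏ k, (ENNReal.ofReal (g k) ^ r k * ENNReal.ofReal (Real.exp (-(t * g k)))) =
        (∏ k, ENNReal.ofReal (g k) ^ r k) *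
          ENNReal.ofReal (t ^ ((M : ℝ) - 1) * Real.exp (-((∑ j, g j) * t))) := by
      intro t ht
      rw [Finset.prod_mul_distrib, ← ENNReal.ofReal_prod_of_nonneg fun k _ => (Real.exp_pos _).le,
        ← Real.exp_sum, ENNReal.ofReal_mul (by positivity), Finset.sum_neg_distrib,
        ← Finset.mul_sum, mul_comm t]
      ring
    rw [setLIntegral_congr_fun measurableSet_Ioi e1, lintegral_const_mul _ (by fun_prop),
      lintegral_rpow_mul_exp hM0 hS, ENNReal.ofReal_mul hG.le, mul_left_comm]
    congr 1
    have e2 : ∀ k, ENNReal.ofReal (g k / ∑ j, g j) ^ r k =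
        ENNReal.ofReal (g k) ^ r k * ENNReal.ofReal (∑ j, g j)⁻¹ ^ r k := fun k => by
      rw [div_eq_mul_inv, ENNReal.ofReal_mul (hg k).le, mul_pow]
    simp only [e2]
    rw [Finset.prod_mul_distrib, Finset.prod_pow_eq_pow_sum, ← ENNReal.ofReal_pow (by positivity),
      Real.rpow_neg hS.le, Real.rpow_natCast, inv_pow]
  rw [lintegral_const_mul _ (by fun_prop), lintegral_lintegral_swap (by fun_prop)] at h1
  have h2 : ∀ t : ℝ, 0 < t → ∫⁻ g, ENNReal.ofReal (t ^ ((M : ℝ) - 1)) *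
        ∏ k, (ENNReal.ofReal (g k) ^ r k * ENNReal.ofReal (Real.exp (-(t * g k))))
      ∂(Measure.pi fun k => gammaMeasure (a k) 1) =
      ENNReal.ofReal (∏ k, (ascPochhammer ℝ (r k)).eval (a k)) *
        ENNReal.ofReal (t ^ ((M : ℝ) - 1) * (1 + t) ^ (-(A + M))) := by
    intro t ht
    rw [lintegral_const_mul _ (by fun_prop), lintegral_pi_prod (fun k => gammaMeasure (a k) 1)
      (fun k x => ENNReal.ofReal x ^ r k * ENNReal.ofReal (Real.exp (-(t * x)))) (by fun_prop)]
    simp only [lintegral_pow_mul_exp_gammaMeasure (ha _) ht.le]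
    have hp : ∀ k, 0 ≤ (ascPochhammer ℝ (r k)).eval (a k) :=
      fun k => (ascPochhammer_pos _ _ (ha k)).le
    rw [← ENNReal.ofReal_prod_of_nonneg fun k _ => mul_nonneg (hp k) (by positivity),
      ← ENNReal.ofReal_mul (by positivity),
      ← ENNReal.ofReal_mul (Finset.prod_nonneg fun k _ => hp k), Finset.prod_mul_distrib,
      ← Real.rpow_sum_of_pos (by positivity), Finset.sum_neg_distrib, Finset.sum_add_distrib,
      ← Nat.cast_sum]
    congr 1
    ring
  rw [setLIntegral_congr_fun measurableSet_Ioi h2, lintegral_const_mul _ (by fun_prop),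
    lintegral_rpow_mul_one_add_rpow hM0 hA, Gamma_add_natCast hA] at h1
  have hGA := Real.Gamma_pos_of_pos hA
  have hpA := ascPochhammer_pos M A hA
  have hp : 0 ≤ ∏ k, (ascPochhammer ℝ (r k)).eval (a k) :=
    Finset.prod_nonneg fun k _ => (ascPochhammer_pos _ _ (ha k)).le
  have h3 : ENNReal.ofReal (Real.Gamma M) * ENNReal.ofReal (dirichletMoment a r) =
      ENNReal.ofReal (∏ k, (ascPochhammer ℝ (r k)).eval (a k)) * ENNReal.ofReal
        (Real.Gamma M * Real.Gamma A / ((ascPochhammer ℝ M).eval A * Real.Gamma A)) := by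
    rw [← ENNReal.ofReal_mul hG.le, ← ENNReal.ofReal_mul hp, dirichletMoment]
    congr 1
    change Real.Gamma M * (_ / (ascPochhammer ℝ M).eval A) = _
    field_simp
  rw [← h3] at h1
  exact (ENNReal.mul_right_inj (by simpa using hG) ENNReal.ofReal_ne_top).1 h1

/-- The integrand times the density is a multiple of the beta density with parameters `a + m` and `b
+ n`. -/
theorem lintegral_betaMeasure {a b : ℝ} (ha : 0 < a) (hb : 0 < b) (m n : ℕ) :
    ∫⁻ x, ENNReal.ofReal x ^ m * ENNReal.ofReal (1 - x) ^ n ∂betaMeasure a b =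
      ENNReal.ofReal ((ascPochhammer ℝ m).eval a * (ascPochhammer ℝ n).eval b /
        (ascPochhammer ℝ (m + n)).eval (a + b)) := by
  have hm : ∀ a b, Measurable (betaPDF a b) := fun a b =>
    (measurable_betaPDFReal a b).ennreal_ofReal
  have ham : 0 < a + m := by positivity
  have hbn : 0 < b + n := by positivity
  have hB := beta_pos ha hb
  have hB' := beta_pos ham hbn
  rw [betaMeasure, lintegral_withDensity_eq_lintegral_mul _ (hm a b) (by fun_prop)]
  have h : ∀ x, (betaPDF a b * fun x => ENNReal.ofReal x ^ m * ENNReal.ofReal (1 - x) ^ n) x =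
      ENNReal.ofReal (beta (a + m) (b + n) / beta a b) * betaPDF (a + m) (b + n) x := by
    intro x
    rw [Pi.mul_apply]
    rcases le_or_gt x 0 with h0 | h0
    · simp [betaPDF_eq_zero_of_nonpos h0]
    rcases le_or_gt 1 x with h1 | h1
    · simp [betaPDF_eq_zero_of_one_le h1]
    have hx : 0 < 1 - x := by linarith
    rw [betaPDF_of_pos_lt_one h0 h1, betaPDF_of_pos_lt_one h0 h1, ← ENNReal.ofReal_pow h0.le,
      ← ENNReal.ofReal_pow hx.le, ← ENNReal.ofReal_mul (by positivity),
      ← ENNReal.ofReal_mul (by positivity), ← ENNReal.ofReal_mul (by positivity)]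
    congr 1
    rw [show a + m - 1 = a - 1 + m by ring, show b + n - 1 = b - 1 + n by ring,
      Real.rpow_add h0, Real.rpow_add hx, Real.rpow_natCast, Real.rpow_natCast]
    field_simp
  simp only [h]
  rw [lintegral_const_mul _ (hm _ _), lintegral_betaPDF_eq_one ham hbn, mul_one]
  congr 1
  have hG1 := Real.Gamma_pos_of_pos ha
  have hG2 := Real.Gamma_pos_of_pos hb
  have hG3 := Real.Gamma_pos_of_pos (add_pos ha hb)
  have hp := ascPochhammer_pos (m + n) (a + b) (add_pos ha hb)
  rw [beta, beta, show a + m + (b + n) = a + b + ((m + n : ℕ) : ℝ) by push_cast; ring,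
    Gamma_add_natCast ha, Gamma_add_natCast hb, Gamma_add_natCast (add_pos ha hb)]
  field_simp

theorem ae_betaMeasure_mem_Ioo (a b : ℝ) : ∀ᵐ x ∂betaMeasure a b, 0 < x ∧ x < 1 := by
  have hm : Measurable (betaPDF a b) := (measurable_betaPDFReal a b).ennreal_ofReal
  rw [betaMeasure, ae_withDensity_iff hm]
  refine ae_of_all _ fun x hx => ⟨?_, ?_⟩
  · by_contra! h
    exact hx (betaPDF_eq_zero_of_nonpos h)
  · by_contra! h
    exact hx (betaPDF_eq_zero_of_one_le h)

/-! ### The two paintboxes as splitting schemes -/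

section Schemes

/-- The splitting scheme of stick-breaking: at every level, the factor `W` goes on and the rest is
broken off. -/
def stickSplitting {Ω : Type*} (W : ℕ → Ω → ℝ) (v : List Unit) (ω : Ω) : Option Unit → ℝ
  | some _ => W v.length ω
  | none => 1 - W v.length ω

theorem solidSize_stickSplitting {Ω : Type*} (W : ℕ → Ω → ℝ) (ω : Ω) (w : List Unit) :
    solidSize (fun v => stickSplitting W v ω) w =
      (∏ i ∈ Finset.range w.length, W i ω) * (1 - W w.length ω) := by
  have h : ∀ w, crumbSize (fun v => stickSplitting W v ω) w =
      ∏ i ∈ Finset.range w.length, W i ω := by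
    intro w
    induction w with
    | nil => simp [crumbSize]
    | cons i w ih => rw [crumbSize, ih, List.length_cons, Finset.prod_range_succ]; rfl
  rw [solidSize, h]
  rfl

theorem length_injective_of_unit : Function.Injective (List.length : List Unit → ℕ) :=
  fun _ _ h => List.ext_getElem h fun _ _ _ => rfl

variable {Ω : Type*} [MeasurableSpace Ω] {μ : Measure Ω}

/-- The `d + 1` crumb parameters add up to `α/d + α`, so the constant `τ = α/d` satisfies the sum
rule. This is why `θ = α/d`. -/
theorem isSplittingScheme_of_dirichlet {d : ℕ} (hd : 1 ≤ d) {α : ℝ} (hα0 : 0 < α) (hα1 : α < 1)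
    {D : List (Fin (d + 1)) → Ω → Option (Fin (d + 1)) → ℝ} (hDmeas : ∀ w, Measurable (D w))
    (hDlaw : ∀ w, μ.map (D w) = dirichletMeasure (splittingParam d α)) (hDindep : iIndepFun D μ) :
    IsSplittingScheme μ α (fun _ => α / d) D := by
  have hd0 : (0 : ℝ) < d := by exact_mod_cast hd
  have hpos : ∀ k, 0 < splittingParam d α k := by
    rintro (_ | i)
    · exact sub_pos.2 hα1
    · exact div_pos hα0 hd0
  have hparam : splitParam α (fun _ : Fin (d + 1) => α / d) = splittingParam d α := by
    funext k
    rcases k with _ | i <;> rfl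
  have hae : ∀ v, ∀ᵐ ω ∂μ, (∀ k, 0 ≤ D v ω k) ∧ ∑ k, D v ω k = 1 := fun v =>
    ae_of_ae_map (hDmeas v).aemeasurable (hDlaw v ▸ ae_dirichletMeasure hpos)
  refine ⟨hDmeas, hDindep, fun v => (hae v).mono fun ω h => h.1,
    fun v => (hae v).mono fun ω h => h.2, fun v r => ?_, fun _ => div_pos hα0 hd0, fun _ => ?_⟩
  · rw [hparam, ← lintegral_dirichletMeasure hpos, ← hDlaw v,
      lintegral_map (by fun_prop) (hDmeas v)]
  · simp
    field_simp
    ring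

/-- A beta variable and its complement form a Dirichlet pair. At depth `j` the only child has
parameter `θ + (j+1)α`, so the sum rule is immediate. -/
theorem isSplittingScheme_stickSplitting {α θ : ℝ} (hα0 : 0 < α) (hα1 : α < 1) (hθ : 0 < θ)
    {W : ℕ → Ω → ℝ} (hWmeas : ∀ j, Measurable (W j)) (hW : iIndepFun W μ)
    (hWlaw : ∀ j : ℕ, μ.map (W j) = betaMeasure (θ + (j + 1) * α) (1 - α)) :
    IsSplittingScheme μ α (fun v : List Unit => θ + v.length * α) (stickSplitting W) := by
  let g : ℝ → Option Unit → ℝ := fun x k => match k with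
    | some _ => x
    | none => 1 - x
  have hg : Measurable g := by
    refine measurable_pi_iff.2 fun k => ?_
    rcases k with _ | _
    · exact measurable_const.sub measurable_id
    · exact measurable_id
  have hst : stickSplitting W = fun v ω => g (W v.length ω) := by
    funext v ω k
    rcases k with _ | _ <;> rfl
  have hae : ∀ j, ∀ᵐ ω ∂μ, 0 < W j ω ∧ W j ω < 1 := fun j =>
    ae_of_ae_map (hWmeas j).aemeasurable (hWlaw j ▸ ae_betaMeasure_mem_Ioo _ _)
  refine ⟨fun v => ?_, ?_, fun v => ?_, fun v => ?_, fun v r => ?_, fun v => by positivity,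
    fun v => ?_⟩
  · rw [hst]
    exact hg.comp (hWmeas _)
  · rw [hst]
    exact (hW.precomp length_injective_of_unit).comp (fun _ => g) fun _ => hg
  · filter_upwards [hae v.length] with ω hω k
    rcases k with _ | _
    · exact sub_nonneg.2 hω.2.le
    · exact hω.1.le
  · refine ae_of_all _ fun ω => ?_
    simp [Fintype.sum_option, stickSplitting]
  · have hpos : 0 < θ + ((v.length : ℝ) + 1) * α := by positivity
    have h1 := lintegral_betaMeasure hpos (sub_pos.2 hα1) (r (some ())) (r none)
    rw [← hWlaw v.length, lintegral_map (by fun_prop) (hWmeas _)] at h1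
    simp only [Fintype.prod_option, stickSplitting, Finset.univ_unique, Finset.prod_singleton,
      dirichletMoment, splitParam, Fintype.sum_option, Finset.sum_singleton, List.length_cons]
    simp only [PUnit.default_eq_unit, Nat.cast_add, Nat.cast_one]
    simp only [mul_comm (ENNReal.ofReal (1 - _) ^ _)]
    rw [h1, mul_comm (Polynomial.eval (1 - α) _), add_comm (r none), add_comm (1 - α)]
  · simp
    ring

end Schemes

/-! ### Random partitions and their finite restrictions -/

section Partitions

/-- The restriction of a partition of `ℕ` to the first `n` balls. -/
def restrictFin (n : ℕ) (s : Setoid ℕ) : Setoid (Fin n) := s.comap Fin.val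

/-- The size of a block of a partition. -/
noncomputable def blockSize {X : Type*} {π : Setoid X} (q : Quotient π) : ℕ :=
  Nat.card {x : X // (⟦x⟧ : Quotient π) = q}

theorem blockSize_ne_zero {X : Type*} [Finite X] {π : Setoid X} (q : Quotient π) :
    blockSize q ≠ 0 := by
  obtain ⟨x, rfl⟩ := Quotient.exists_rep q
  have : Nonempty {y : X // (⟦y⟧ : Quotient π) = ⟦x⟧} := ⟨⟨x, rfl⟩⟩
  exact Nat.card_pos.ne'

theorem sum_blockSize {X : Type*} [Finite X] (π : Setoid X) [Fintype (Quotient π)] :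
    ∑ q : Quotient π, blockSize q = Nat.card X := by
  rw [← Nat.card_congr (Equiv.sigmaFiberEquiv (Quotient.mk π)), Nat.card_sigma]
  rfl

theorem restrictFin_colorPartition_eq_iff {Ω J : Type*} (C : ℕ → Ω → J) (ω : Ω) {n : ℕ}
    (π : Setoid (Fin n)) :
    restrictFin n (colorPartition C ω) = π ↔
      ∃ c : Quotient π ↪ J, ∀ k : Fin n, C k ω = c ⟦k⟧ := by
  constructor
  · rintro h
    have hr : ∀ a b : Fin n, π a b ↔ C a ω = C b ω := fun a b => by rw [← h]; rfl
    refine ⟨⟨Quotient.lift (fun k : Fin n => C k ω) fun a b hab => (hr a b).1 hab, ?_⟩,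
      fun k => rfl⟩
    rintro ⟨a⟩ ⟨b⟩ hab
    exact Quotient.sound ((hr a b).2 hab)
  · rintro ⟨c, hc⟩
    ext a b
    change C a ω = C b ω ↔ _
    rw [hc, hc, c.injective.eq_iff, Quotient.eq]

variable {Ω J : Type*} [MeasurableSpace Ω] [Countable J] {μ : Measure Ω}

/-- The event is the disjoint union, over injective colorings of the blocks of `π`, of the events
that the balls get these colors. -/
theorem measure_restrictFin_colorPartition {P : J → Ω → ℝ} (hP : ∀ j, Measurable (P j))
    {C : ℕ → Ω → J} (hC : IsPaintboxSample μ P C) {n : ℕ} (π : Setoid (Fin n))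
    [Fintype (Quotient π)] :
    μ {ω | restrictFin n (colorPartition C ω) = π} =
      ∫⁻ ω, injSum (fun j => ENNReal.ofReal (P j ω)) (blockSize (π := π)) ∂μ := by
  classical
  have : Countable (Quotient π ↪ J) := DFunLike.coe_injective.countable
  have hset : {ω | restrictFin n (colorPartition C ω) = π} =
      ⋃ c : Quotient π ↪ J, {ω | ∀ k : Fin n, C k ω = c ⟦k⟧} := by
    ext ω
    simp [restrictFin_colorPartition_eq_iff]
  have hprod : ∀ (c : Quotient π ↪ J) ω, ∏ k : Fin n, ENNReal.ofReal (P (c ⟦k⟧) ω) =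
      ∏ q, ENNReal.ofReal (P (c q) ω) ^ blockSize q := by
    intro c ω
    rw [← Fintype.prod_fiberwise' (Quotient.mk π) fun q => ENNReal.ofReal (P (c q) ω)]
    refine Finset.prod_congr rfl fun q _ => ?_
    rw [Finset.prod_const, Finset.card_univ, ← Nat.card_eq_fintype_card]
    rfl
  rw [hset, measure_iUnion]
  · unfold injSum
    rw [lintegral_tsum fun c => ?_]
    · refine tsum_congr fun c => ?_
      have := hC.2 n (fun k => c ⟦k⟧) Set.univ MeasurableSet.univ
      simp only [Set.mem_univ, true_and, Set.ofPred_true, Measure.restrict_univ, hprod] at this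
      exact this
    · exact (Finset.measurable_prod _ fun q _ =>
        ((hP (c q)).ennreal_ofReal.pow_const _)).aemeasurable
  · intro c c' hcc'
    rw [Function.onFun, Set.disjoint_left]
    intro ω h h'
    refine hcc' (DFunLike.ext _ _ fun q => ?_)
    obtain ⟨k, rfl⟩ := Quotient.exists_rep q
    exact (h k).symm.trans (h' k)
  · intro c
    have : {ω | ∀ k : Fin n, C k ω = c ⟦k⟧} = ⋂ k : Fin n, {ω | C k ω = c ⟦k⟧} := by
      ext ω; simp
    rw [this]
    exact MeasurableSet.iInter fun k => hC.1 _ _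

theorem measurable_colorPartition {C : ℕ → Ω → J} (hC : ∀ n j, MeasurableSet {ω | C n ω = j}) :
    Measurable (colorPartition C) := by
  refine measurable_comap_iff.2 (measurable_pi_iff.2 fun a => measurable_pi_iff.2 fun b => ?_)
  refine measurableSet_setOfPred.1 ?_
  have : {ω | C a ω = C b ω} = ⋃ j, ({ω | C a ω = j} ∩ {ω | C b ω = j}) := by
    ext ω; simp [eq_comm]
  change MeasurableSet {ω | C a ω = C b ω}
  rw [this]
  exact MeasurableSet.iUnion fun j => (hC a j).inter (hC b j)

theorem measurableSet_rel (a b : ℕ) : MeasurableSet {s : Setoid ℕ | s a b} := by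
  have h : Measurable fun s : Setoid ℕ => fun m n => s.r m n := comap_measurable _
  exact measurableSet_setOfPred.2 ((measurable_pi_apply b).comp ((measurable_pi_apply a).comp h))

instance finite_setoid {X : Type*} [Finite X] : Finite (Setoid X) :=
  Finite.of_injective (fun (s : Setoid X) a b => s a b) fun s t h => by
    ext a b
    exact iff_of_eq (congrFun (congrFun h a) b)

theorem measurableSet_restrictFin_eq {n : ℕ} (π : Setoid (Fin n)) :
    MeasurableSet {s : Setoid ℕ | restrictFin n s = π} := by
  have : {s : Setoid ℕ | restrictFin n s = π} =
      ⋂ a : Fin n, ⋂ b : Fin n, {s : Setoid ℕ | s a b ↔ π a b} := by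
    ext s
    simp only [Set.mem_ofPred_eq, Set.mem_iInter]
    exact ⟨fun h a b => by rw [← h]; rfl, fun h => Setoid.ext h⟩
  rw [this]
  refine MeasurableSet.iInter fun a => MeasurableSet.iInter fun b => ?_
  by_cases hab : π a b
  · simp only [hab, iff_true]
    exact measurableSet_rel a b
  · simp only [hab, iff_false]
    exact (measurableSet_rel a b).compl

theorem measurableSet_restrictFin_preimage {n : ℕ} (A : Set (Setoid (Fin n))) :
    MeasurableSet (restrictFin n ⁻¹' A) := by
  rw [← Set.biUnion_preimage_singleton]
  exact MeasurableSet.biUnion A.to_countable fun π _ => measurableSet_restrictFin_eq π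

/-- A probability measure on partitions of `ℕ` is determined by the restrictions to finite sets. -/
theorem ext_of_restrictFin {ρ ρ' : Measure (Setoid ℕ)} [IsProbabilityMeasure ρ]
    [IsProbabilityMeasure ρ']
    (h : ∀ n (π : Setoid (Fin n)), ρ {s | restrictFin n s = π} = ρ' {s | restrictFin n s = π}) :
    ρ = ρ' := by
  let G : Set (Set (Setoid ℕ)) := {S | ∃ n, ∃ A : Set (Setoid (Fin n)), S = restrictFin n ⁻¹' A}
  have hmono : ∀ {n N : ℕ} (hnN : n ≤ N) (A : Set (Setoid (Fin n))),
      restrictFin n ⁻¹' A = restrictFin N ⁻¹' ((Setoid.comap (Fin.castLE hnN)) ⁻¹' A) :=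
    fun hnN A => rfl
  refine ext_of_generate_finite G ?_ ?_ ?_ ?_
  · refine le_antisymm ?_ ?_
    · refine measurable_iff_comap_le.1 ?_
      refine @measurable_pi_lambda _ _ _ (MeasurableSpace.generateFrom G) _ _ fun a => ?_
      refine @measurable_pi_lambda _ _ _ (MeasurableSpace.generateFrom G) _ _ fun b => ?_
      refine (@measurableSet_setOfPred _ (MeasurableSpace.generateFrom G) _).1 ?_
      -- Restriction to the first `max a b + 1` balls contains both `a` and `b`.
      refine MeasurableSpace.measurableSet_generateFrom ⟨max a b + 1,
        {π | π ⟨a, by omega⟩ ⟨b, by omega⟩}, rfl⟩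
    · refine MeasurableSpace.generateFrom_le ?_
      rintro _ ⟨n, A, rfl⟩
      exact measurableSet_restrictFin_preimage A
  · rintro _ ⟨n, A, rfl⟩ _ ⟨n', A', rfl⟩ -
    rw [hmono (le_max_left n n'), hmono (le_max_right n n')]
    exact ⟨max n n', _, (Set.preimage_inter).symm⟩
  · rintro _ ⟨n, A, rfl⟩
    rw [← Set.biUnion_preimage_singleton, measure_biUnion A.to_countable,
      measure_biUnion A.to_countable]
    · exact tsum_congr fun π => h n π
    · exact Set.PairwiseDisjoint.mono (fun a _ b _ hab => Disjoint.preimage _ (by simpa))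
        (fun _ => le_rfl)
    · exact fun π _ => measurableSet_restrictFin_eq π
    · exact Set.PairwiseDisjoint.mono (fun a _ b _ hab => Disjoint.preimage _ (by simpa))
        (fun _ => le_rfl)
    · exact fun π _ => measurableSet_restrictFin_eq π
  · simp

end Partitions

/-! ### Counting partitions with given block sizes -/

section Counting

theorem exists_equiv_comp_eq {X Y R : Type*} [Finite X] [Finite Y] (u : X → R) (v : Y → R)
    (h : ∀ r, Nat.card {x // u x = r} = Nat.card {y // v y = r}) :
    ∃ e : X ≃ Y, ∀ x, v (e x) = u x := by
  let e : ∀ r, {x // u x = r} ≃ {y // v y = r} := fun r => (Finite.card_eq.1 (h r)).some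
  refine ⟨(Equiv.sigmaFiberEquiv u).symm.trans ((Equiv.sigmaCongrRight e).trans
    (Equiv.sigmaFiberEquiv v)), fun x => ?_⟩
  exact (e (u x) ⟨x, rfl⟩).2

/-- Orbit–stabilizer: every admissible `f` is `f₀ ∘ e` for some permutation `e`, and `f₀` is fixed
by exactly `∏ b, (m b)!` permutations. -/
theorem card_fiber_prescribed_mul {X B : Type*} [Finite X] [Fintype B] (m : B → ℕ)
    (hm : ∑ b, m b = Nat.card X) :
    Nat.card {f : X → B // ∀ b, Nat.card {x // f x = b} = m b} * ∏ b, (m b).factorial =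
      (Nat.card X).factorial := by
  classical
  have := Fintype.ofFinite X
  have e₀ : X ≃ Σ b, Fin (m b) := (Finite.card_eq.1 (by rw [← hm, Nat.card_sigma]; simp)).some
  let f₀ : X → B := fun x => (e₀ x).1
  have hf₀ : ∀ b, Nat.card {x // f₀ x = b} = m b := fun b => by
    rw [Nat.card_congr (e₀.subtypeEquiv (q := fun p => p.1 = b) fun x => Iff.rfl),
      Nat.card_congr (Equiv.sigmaSubtype b)]
    simp
  have hstab : Nat.card {g : Equiv.Perm X // f₀ ∘ g = f₀} = ∏ b, (m b).factorial := by
    rw [Nat.card_eq_fintype_card, DomMulAct.stabilizer_card]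
    exact Finset.prod_congr rfl fun b _ => by rw [← Nat.card_eq_fintype_card, hf₀]
  have hex : ∀ f : {f : X → B // ∀ b, Nat.card {x // f x = b} = m b},
      ∃ e : X ≃ X, ∀ x, f₀ (e x) = f.1 x := fun f =>
    exists_equiv_comp_eq f.1 f₀ fun b => by rw [f.2, hf₀]
  choose E hE using hex
  rw [← hstab, ← Nat.card_prod, ← Fintype.card_perm (α := X) |>.trans (by
    rw [Nat.card_eq_fintype_card] : _ = (Nat.card X).factorial), ← Nat.card_eq_fintype_card]
  refine Nat.card_congr (Equiv.ofBijective (fun p => (E p.1).trans p.2.1) ⟨?_, ?_⟩)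
  · rintro ⟨f, g, hg⟩ ⟨f', g', hg'⟩ h
    have hval : ∀ (f) (g : Equiv.Perm X) (hg : f₀ ∘ g = f₀) x, f₀ (g (E f x)) = f.1 x :=
      fun f g hg x => by rw [← hE f x]; exact congrFun hg _
    have hff : f = f' := Subtype.ext (funext fun x => by
      rw [← hval f g hg x, ← hval f' g' hg' x]
      exact congrArg f₀ (DFunLike.congr_fun h x))
    subst hff
    refine Prod.ext rfl (Subtype.ext (Equiv.ext fun x => ?_))
    have := DFunLike.congr_fun h ((E f).symm x)
    simpa using this
  · intro p
    let f : {f : X → B // ∀ b, Nat.card {x // f x = b} = m b} := ⟨f₀ ∘ p, fun b => by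
      rw [← hf₀ b]
      exact Nat.card_congr (p.subtypeEquiv fun _ => Iff.rfl)⟩
    refine ⟨⟨f, (E f).symm.trans p, ?_⟩, ?_⟩
    · funext x
      have := hE f ((E f).symm x)
      simp only [Equiv.apply_symm_apply] at this
      rw [this]
      rfl
    · ext x
      simp

theorem card_fiber_eq_blockSize {X B : Type*} {π : Setoid X} (e : Quotient π ≃ B) (b : B) :
    Nat.card {x : X // e ⟦x⟧ = b} = blockSize (e.symm b) :=
  Nat.card_congr (Equiv.subtypeEquivRight fun _ => (Equiv.eq_symm_apply e).symm)

/-- The partitions with `k r` blocks of size `r`, for all `r`. -/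
def HasBlockCounts {n : ℕ} (k : ℕ → ℕ) (π : Setoid (Fin n)) : Prop :=
  ∀ r ∈ Finset.Icc 1 n, Nat.card {q : Quotient π // blockSize q = r} = k r

theorem blockSize_mem_Icc {n : ℕ} {π : Setoid (Fin n)} (q : Quotient π) :
    blockSize q ∈ Finset.Icc 1 n := by
  refine Finset.mem_Icc.2 ⟨Nat.one_le_iff_ne_zero.2 (blockSize_ne_zero q), ?_⟩
  exact (Finite.card_subtype_le _).trans (by simp)

/-- Let `B` consist of `k r` labeled slots of size `r` for each `r`. Fillings of the slots are
counted by the multinomial coefficient, and each partition arises from `∏ r, (k r)!` of them, by the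
size-preserving permutations of the slots. -/
theorem card_hasBlockCounts_mul {n : ℕ} (k : ℕ → ℕ) (hk : ∑ r ∈ Finset.Icc 1 n, r * k r = n) :
    Nat.card {π : Setoid (Fin n) // HasBlockCounts k π} *
      ∏ r ∈ Finset.Icc 1 n, (r.factorial ^ k r * (k r).factorial) = n.factorial := by
  classical
  let B := Σ r : Finset.Icc 1 n, Fin (k r)
  let m : B → ℕ := fun b => b.1
  have hcardfst : ∀ r : Finset.Icc 1 n, Nat.card {b : B // b.1 = r} = k r := fun r => by
    rw [Nat.card_congr (Equiv.sigmaSubtype r)]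
    simp
  have hm : ∑ b, m b = Nat.card (Fin n) := by
    rw [Fintype.sum_sigma]
    simp only [m, Finset.sum_const, Finset.card_univ, Fintype.card_fin, smul_eq_mul, Nat.card_fin]
    rw [Finset.sum_coe_sort (Finset.Icc 1 n) fun r => k r * r]
    simpa only [mul_comm] using hk
  have hm0 : ∀ b, m b ≠ 0 := fun b => Nat.one_le_iff_ne_zero.1 (Finset.mem_Icc.1 b.1.2).1
  let F := {f : Fin n → B // ∀ b, Nat.card {x // f x = b} = m b}
  have hsurj : ∀ f : F, Function.Surjective f.1 := fun f b => by
    have h : Nat.card {x // f.1 x = b} ≠ 0 := by rw [f.2]; exact hm0 b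
    obtain ⟨⟨x, hx⟩⟩ := (Nat.card_ne_zero.1 h).1
    exact ⟨x, hx⟩
  have hF := card_fiber_prescribed_mul m hm
  have hstab : Nat.card {g : Equiv.Perm B // (Sigma.fst ∘ g : B → _) = Sigma.fst} =
      ∏ r ∈ Finset.Icc 1 n, (k r).factorial := by
    rw [Nat.card_eq_fintype_card, DomMulAct.stabilizer_card,
      ← Finset.prod_coe_sort (Finset.Icc 1 n) fun r => (k r).factorial]
    exact Finset.prod_congr rfl fun r _ => by rw [← Nat.card_eq_fintype_card, hcardfst]
  have hfact : ∏ b, (m b).factorial = ∏ r ∈ Finset.Icc 1 n, r.factorial ^ k r := by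
    rw [Fintype.prod_sigma, ← Finset.prod_coe_sort (Finset.Icc 1 n) fun r => r.factorial ^ k r]
    simp [m]
  have hex : ∀ π : {π : Setoid (Fin n) // HasBlockCounts k π},
      ∃ e : Quotient π.1 ≃ B, ∀ q, m (e q) = blockSize q := fun π => by
    obtain ⟨e, he⟩ := exists_equiv_comp_eq (X := Quotient π.1) (Y := B)
      (fun q => (⟨blockSize q, blockSize_mem_Icc q⟩ : Finset.Icc 1 n)) Sigma.fst fun r => by
        rw [hcardfst, ← π.2 r.1 r.2]
        exact Nat.card_congr (Equiv.subtypeEquivRight fun q => Subtype.ext_iff)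
    exact ⟨e, fun q => congrArg Subtype.val (he q)⟩
  choose E hE using hex
  have hcount : Nat.card F = Nat.card {π : Setoid (Fin n) // HasBlockCounts k π} *
      ∏ r ∈ Finset.Icc 1 n, (k r).factorial := by
    rw [← hstab, ← Nat.card_prod]
    refine (Nat.card_congr (Equiv.ofBijective
      (fun p => (⟨fun x => p.2.1 (E p.1 ⟦x⟧), fun b => ?_⟩ : F)) ⟨?_, ?_⟩)).symm
    · have := card_fiber_eq_blockSize ((E p.1).trans p.2.1) b
      refine this.trans ?_
      rw [← hE p.1]
      have h := congrFun p.2.2 (p.2.1.symm b)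
      simp only [Function.comp_apply, Equiv.apply_symm_apply] at h
      simp [m, h]
    · rintro ⟨π, g, hg⟩ ⟨π', g', hg'⟩ h
      have hfun : ∀ x, g (E π ⟦x⟧) = g' (E π' ⟦x⟧) := fun x =>
        congrFun (congrArg Subtype.val h) x
      have hππ : π = π' := Subtype.ext (Setoid.ext fun a b => by
        rw [← Quotient.eq (r := π.1), ← Quotient.eq (r := π'.1), ← (E π).injective.eq_iff,
          ← g.injective.eq_iff, hfun, hfun, g'.injective.eq_iff, (E π').injective.eq_iff])
      subst hππ
      refine Prod.ext rfl (Subtype.ext (Equiv.ext fun b => ?_))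
      obtain ⟨x, hx⟩ := Quotient.exists_rep ((E π).symm b)
      have := hfun x
      rw [hx] at this
      simpa using this
    · intro f
      let e : Quotient (Setoid.ker f.1) ≃ B := Setoid.quotientKerEquivOfSurjective f.1 (hsurj f)
      have he : ∀ x, e ⟦x⟧ = f.1 x := fun x => rfl
      have hsize : ∀ q, blockSize q = m (e q) := fun q => by
        rw [← f.2, ← e.symm_apply_apply q, ← card_fiber_eq_blockSize]
        simp only [Equiv.symm_apply_apply]
        rfl
      let π : {π : Setoid (Fin n) // HasBlockCounts k π} := ⟨Setoid.ker f.1, fun r hr => by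
        rw [← hcardfst ⟨r, hr⟩]
        exact Nat.card_congr (e.subtypeEquiv fun q => by
          rw [hsize]
          exact (Subtype.ext_iff (a1 := (e q).1) (a2 := ⟨r, hr⟩)).symm)⟩
      refine ⟨⟨π, (E π).symm.trans e, ?_⟩, ?_⟩
      · funext b
        refine Subtype.ext ?_
        change m (e ((E π).symm b)) = m b
        have h1 := hE π ((E π).symm b)
        rw [Equiv.apply_symm_apply] at h1
        rw [h1]
        exact (hsize _).symm
      · refine Subtype.ext (funext fun x => ?_)
        simp only [Equiv.trans_apply, Equiv.symm_apply_apply]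
        exact he x
  rw [Finset.prod_mul_distrib, ← hfact, mul_comm (∏ b, (m b).factorial), ← mul_assoc, ← hcount, hF,
    Nat.card_fin]

end Counting

/-! ### The sampling formula and equality in law -/

section SamplingFormula

theorem blockCount_eq_card (s : Setoid ℕ) (n r : ℕ) :
    blockCount s n r = Nat.card {q : Quotient (restrictFin n s) // blockSize q = r} := by
  unfold blockCount
  rw [← Nat.card_coe_set_eq]
  let e : Quotient (restrictFin n s) ≃ (restrictFin n s).classes :=
    Setoid.quotientEquivClasses (restrictFin n s)
  have he : ∀ q, blockSize q = (e q : Set (Fin n)).ncard := fun q => by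
    obtain ⟨x, rfl⟩ := Quotient.exists_rep q
    rw [blockSize, ← Nat.card_coe_set_eq]
    refine Nat.card_congr (Equiv.subtypeEquivRight fun y => ?_)
    rw [Quotient.eq]
    rfl
  refine (Nat.card_congr ((e.subtypeEquiv
    (q := fun B : (restrictFin n s).classes => (B : Set (Fin n)).ncard = r)
    fun q => by rw [he]).trans ?_)).symm
  exact Equiv.subtypeSubtypeEquivSubtypeInter (fun B => B ∈ (restrictFin n s).classes)
    fun B => B.ncard = r

theorem hasBlockCounts_restrictFin_iff (s : Setoid ℕ) (n : ℕ) (k : ℕ → ℕ) :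
    HasBlockCounts k (restrictFin n s) ↔ ∀ r ∈ Finset.Icc 1 n, blockCount s n r = k r := by
  simp only [HasBlockCounts, blockCount_eq_card]

theorem prod_blockSize {n : ℕ} {k : ℕ → ℕ} {π : Setoid (Fin n)} [Fintype (Quotient π)]
    (hπ : HasBlockCounts k π) {M : Type*} [CommMonoid M] (f : ℕ → M) :
    ∏ q : Quotient π, f (blockSize q) = ∏ r ∈ Finset.Icc 1 n, f r ^ k r := by
  classical
  rw [← Finset.prod_fiberwise_of_maps_to (t := Finset.Icc 1 n) (g := fun q => blockSize q)
    fun q _ => blockSize_mem_Icc q]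
  refine Finset.prod_congr rfl fun r hr => ?_
  rw [Finset.prod_congr rfl fun q hq => by rw [(Finset.mem_filter.1 hq).2], Finset.prod_const,
    ← hπ r hr, Nat.card_eq_fintype_card, Fintype.card_subtype]

theorem card_quotient_eq {n : ℕ} {k : ℕ → ℕ} {π : Setoid (Fin n)} (hπ : HasBlockCounts k π) :
    Nat.card (Quotient π) = ∑ r ∈ Finset.Icc 1 n, k r := by
  classical
  have := Fintype.ofFinite (Quotient π)
  -- In `Multiplicative ℕ` the product formula becomes a sum and counts the blocks.
  have h := prod_blockSize hπ fun _ => Multiplicative.ofAdd 1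
  rw [Finset.prod_const] at h
  simpa [← ofAdd_nsmul, ← ofAdd_sum] using h

theorem ewensPitmanBlocks_blockSize {n : ℕ} {k : ℕ → ℕ} {π : Setoid (Fin n)}
    [Fintype (Quotient π)] (hπ : HasBlockCounts k π) (α θ : ℝ) :
    ewensPitmanBlocks α θ (blockSize (π := π)) =
      (∏ i ∈ Finset.range (∑ r ∈ Finset.Icc 1 n, k r), (θ + i * α)) /
        (ascPochhammer ℝ n).eval θ *
      ∏ r ∈ Finset.Icc 1 n, ((ascPochhammer ℝ (r - 1)).eval (1 - α)) ^ k r := by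
  rw [ewensPitmanBlocks, card_quotient_eq hπ, sum_blockSize, Nat.card_fin,
    prod_blockSize hπ fun r => (ascPochhammer ℝ (r - 1)).eval (1 - α)]

theorem card_mul_eq_ewensPitmanProb {n : ℕ} {k : ℕ → ℕ}
    (hk : ∑ r ∈ Finset.Icc 1 n, r * k r = n) (α θ : ℝ) :
    Nat.card {π : Setoid (Fin n) // HasBlockCounts k π} *
      ((∏ i ∈ Finset.range (∑ r ∈ Finset.Icc 1 n, k r), (θ + i * α)) /
        (ascPochhammer ℝ n).eval θ *
      ∏ r ∈ Finset.Icc 1 n, ((ascPochhammer ℝ (r - 1)).eval (1 - α)) ^ k r) =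
    ewensPitmanProb α θ n k := by
  have h : (Nat.card {π : Setoid (Fin n) // HasBlockCounts k π} : ℝ) *
      ∏ r ∈ Finset.Icc 1 n, ((r.factorial : ℝ) ^ k r * (k r).factorial) = n.factorial := by
    exact_mod_cast card_hasBlockCounts_mul k hk
  have h0 : ∏ r ∈ Finset.Icc 1 n, ((r.factorial : ℝ) ^ k r * (k r).factorial) ≠ 0 :=
    Finset.prod_ne_zero_iff.2 fun r _ => by positivity
  rw [ewensPitmanProb, Finset.prod_div_distrib, ← h, mul_div_assoc', mul_right_comm,
    eq_div_iff h0]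
  ring

/-- A random partition whose restrictions follow the Ewens–Pitman law satisfies the sampling
formula. -/
theorem sampling_formula {Ω : Type*} [MeasurableSpace Ω] {μ : Measure Ω} {X : Ω → Setoid ℕ}
    (hX : Measurable X) {α θ : ℝ} (hα0 : 0 < α) (hα1 : α < 1) (hθ : 0 < θ) {n : ℕ}
    (h : ∀ (π : Setoid (Fin n)) [Fintype (Quotient π)], μ {ω | restrictFin n (X ω) = π} =
      ENNReal.ofReal (ewensPitmanBlocks α θ (blockSize (π := π))))
    {k : ℕ → ℕ} (hk : ∑ r ∈ Finset.Icc 1 n, r * k r = n) :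
    μ.real {ω | ∀ r ∈ Finset.Icc 1 n, blockCount (X ω) n r = k r} = ewensPitmanProb α θ n k := by
  classical
  have : Fintype (Setoid (Fin n)) := Fintype.ofFinite _
  have hset : {ω | ∀ r ∈ Finset.Icc 1 n, blockCount (X ω) n r = k r} =
      ⋃ π ∈ Finset.univ.filter (HasBlockCounts (n := n) k),
        {ω | restrictFin n (X ω) = π} := by
    ext ω
    rw [Set.mem_ofPred_eq, ← hasBlockCounts_restrictFin_iff]
    simp
  have hterm : ∀ π ∈ Finset.univ.filter (HasBlockCounts (n := n) k),
      μ.real {ω | restrictFin n (X ω) = π} =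
      (∏ i ∈ Finset.range (∑ r ∈ Finset.Icc 1 n, k r), (θ + i * α)) /
        (ascPochhammer ℝ n).eval θ *
      ∏ r ∈ Finset.Icc 1 n, ((ascPochhammer ℝ (r - 1)).eval (1 - α)) ^ k r := by
    intro π hπ
    rw [measureReal_def, h π, ENNReal.toReal_ofReal (ewensPitmanBlocks_nonneg hα0 hα1 hθ _),
      ewensPitmanBlocks_blockSize (Finset.mem_filter.1 hπ).2]
  have hfin : ∀ π : Setoid (Fin n), μ {ω | restrictFin n (X ω) = π} ≠ ∞ := fun π => by
    rw [h π]; exact ENNReal.ofReal_ne_top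
  rw [hset, measureReal_biUnion_finset ?_ ?_ fun π _ => hfin π, Finset.sum_congr rfl hterm,
    Finset.sum_const, nsmul_eq_mul, ← card_mul_eq_ewensPitmanProb hk, Nat.card_eq_fintype_card,
    Fintype.card_subtype]
  · intro π _ π' _ hne
    rw [Function.onFun, Set.disjoint_left]
    exact fun ω h1 h2 => hne (h1.symm.trans h2)
  · exact fun π _ => hX (measurableSet_restrictFin_eq π)

theorem IsSplittingScheme.measure_restrictFin {ι Ω : Type*} [Fintype ι] [MeasurableSpace Ω]
    {μ : Measure Ω} [IsProbabilityMeasure μ] {α : ℝ} {τ : List ι → ℝ}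
    {D : List ι → Ω → Option ι → ℝ} (h : IsSplittingScheme μ α τ D) (hα0 : 0 < α) (hα1 : α < 1)
    {C : ℕ → Ω → List ι} (hC : IsPaintboxSample μ (fun w ω => solidSize (fun v => D v ω) w) C)
    {n : ℕ} (π : Setoid (Fin n)) [Fintype (Quotient π)] :
    μ {ω | restrictFin n (colorPartition C ω) = π} =
      ENNReal.ofReal (ewensPitmanBlocks α (τ []) (blockSize (π := π))) := by
  rw [measure_restrictFin_colorPartition (fun w => measurable_solidSize (fun u k =>
    (measurable_pi_apply k).comp (h.measurable u)) w) hC, ← h.blockProb_eq hα0 hα1 _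
    blockSize_ne_zero]
  simp only [blockProb]
  congr! 4
  simp [subtreeSolid]

theorem IsPoissonDirichletPaintbox.measure_restrictFin {Ω : Type*} [MeasurableSpace Ω]
    {μ : Measure Ω} [IsProbabilityMeasure μ] {α θ : ℝ} (hα0 : 0 < α) (hα1 : α < 1) (hθ : 0 < θ)
    {P : ℕ → Ω → ℝ} (hP : IsPoissonDirichletPaintbox μ α θ P) {C : ℕ → Ω → ℕ}
    (hC : IsPaintboxSample μ P C) {n : ℕ} (π : Setoid (Fin n)) [Fintype (Quotient π)] :
    μ {ω | restrictFin n (colorPartition C ω) = π} =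
      ENNReal.ofReal (ewensPitmanBlocks α θ (blockSize (π := π))) := by
  obtain ⟨W, hWm, hWi, hWl, hPW⟩ := hP
  have h := isSplittingScheme_stickSplitting hα0 hα1 hθ hWm hWi hWl
  have hPm : ∀ j, Measurable (P j) := fun j => by
    have : P j = fun ω => (∏ i ∈ Finset.range j, W i ω) * (1 - W j ω) := funext (hPW j)
    rw [this]
    fun_prop
  have h1 := h.blockProb_eq hα0 hα1 (blockSize (π := π)) blockSize_ne_zero []
  simp only [List.length_nil, Nat.cast_zero, zero_mul, add_zero] at h1
  rw [measure_restrictFin_colorPartition hPm hC, ← h1]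
  refine lintegral_congr fun ω => ?_
  -- Words over `Unit` are identified with natural numbers by their length.
  rw [← injSum_comp_of_support ⟨List.length, length_injective_of_unit⟩ _ _ blockSize_ne_zero
    fun j _ => ⟨List.replicate j (), List.length_replicate⟩]
  congr 1
  funext w
  simp [subtreeSolid, solidSize_stickSplitting, hPW]

end SamplingFormula

theorem proposition8 {d : ℕ} (hd : 1 ≤ d) {α : ℝ} (hα0 : 0 < α) (hα1 : α < 1)
    {Ω : Type*} [MeasurableSpace Ω] (μ : Measure Ω) [IsProbabilityMeasure μ]
    (D : List (Fin (d + 1)) → Ω → Option (Fin (d + 1)) → ℝ)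
    (hDmeas : ∀ w, Measurable (D w))
    (hDlaw : ∀ w, μ.map (D w) = dirichletMeasure (splittingParam d α))
    (hDindep : iIndepFun D μ) :
    -- the sizes of the solids form a paintbox
    (∀ᵐ ω ∂μ, (∀ w, 0 ≤ solidSize (fun v => D v ω) w) ∧
      HasSum (solidSize fun v => D v ω) 1) ∧
    -- the partition obtained by painting the balls
    ∀ C : ℕ → Ω → List (Fin (d + 1)),
      IsPaintboxSample μ (fun w ω => solidSize (fun v => D v ω) w) C →
      -- has the law of the partition induced by the Poisson–Dirichlet `(α, α/d)` paintbox
      (∀ {Ω' : Type*} [MeasurableSpace Ω'] (ν : Measure Ω') [IsProbabilityMeasure ν]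
        (P : ℕ → Ω' → ℝ) (C' : ℕ → Ω' → ℕ),
        IsPoissonDirichletPaintbox ν α (α / d) P → IsPaintboxSample ν P C' →
        IdentDistrib (colorPartition C) (colorPartition C') μ ν) ∧
      -- and follows the Ewens–Pitman `(α, α/d)` sampling formula
      ∀ (n : ℕ) (k : ℕ → ℕ), ∑ r ∈ Finset.Icc 1 n, r * k r = n →
        μ.real {ω | ∀ r ∈ Finset.Icc 1 n, blockCount (colorPartition C ω) n r = k r} =
          ewensPitmanProb α (α / d) n k := by
  have hd0 : (0 : ℝ) < d := by exact_mod_cast hd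
  have hθ : 0 < α / d := div_pos hα0 hd0
  have h := isSplittingScheme_of_dirichlet hd hα0 hα1 hDmeas hDlaw hDindep
  refine ⟨h.ae_hasSum hα0 hα1, fun C hC => ⟨?_, fun n k hk => ?_⟩⟩
  · intro Ω' _ ν _ P C' hP hC'
    have hm := measurable_colorPartition hC.1
    have hm' := measurable_colorPartition hC'.1
    have := Measure.isProbabilityMeasure_map (μ := μ) hm.aemeasurable
    have := Measure.isProbabilityMeasure_map (μ := ν) hm'.aemeasurable
    refine ⟨hm.aemeasurable, hm'.aemeasurable, ext_of_restrictFin fun n π => ?_⟩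
    have := Fintype.ofFinite (Quotient π)
    rw [Measure.map_apply hm (measurableSet_restrictFin_eq π),
      Measure.map_apply hm' (measurableSet_restrictFin_eq π)]
    exact (h.measure_restrictFin hα0 hα1 hC π).trans
      (hP.measure_restrictFin hα0 hα1 hθ hC' π).symm
  · exact sampling_formula (measurable_colorPartition hC.1) hα0 hα1 hθ
      (fun π _ => h.measure_restrictFin hα0 hα1 hC π) hk
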